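/- Let $q \ge 3$ and $a$ be integers with $(a,q)=1$; $p$ always denotes a prime, $\varphi$ is Euler's function, $\mu$ the Möbius function and $\gamma$ Euler's constant. Let $C(q,a)>0$ be the constant defined by $$\prod_{\substack{p\le x\\ p\equiv a \bmod q}}\Bigl(1-\frac1p\Bigr)=\frac{C(q,a)}{(\log x)^{1/\varphi(q)}}\,(1+o(1))\qquad(x\to+\infty).$$ Put $\alpha(p;q,a)=\varphi(q)-1$ if $p\equiv a \bmod q$ and $\alpha(p;q,a)=-1$ otherwise. For a Dirichlet character $\chi$ modulo $q$ and $B>0$ write $$L_B(\chi,s)=\prod_{p>B}\Bigl(1-\frac{\chi(p)}{p^s}\Bigr)^{-1},\qquad \log L_B(\chi,s)=-\sum_{p>B}\log\Bigl(1-\frac{\chi(p)}{p^s}\Bigr),$$ with principal logarithms on the right, and with product and sum taken in increasing order of $p$. Let $A>0$ be a real number such that every prime divisor of $q$ is at most $Aq$ (for instance any $A\ge 1$). Then the constant $C(q,a)$ exists; for every non-principal character $\chi$ modulo $q$ and all integers $k,m\ge1$ the product $L_{Aq}(\chi^k,km)$ and the sum $\log L_{Aq}(\chi^k,km)$ converge,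 and the latter is a logarithm of the former; the series over $k$ below, and then the series over $m$, converge absolutely; and $$\varphi(q)\log C(q,a)=-\gamma+\log\prod_{p\le Aq}\Bigl(1-\frac1p\Bigr)^{\alpha(p;q,a)}-\sum_{\substack{\chi \bmod q\\ \chi\ne\chi_0}}\overline{\chi}(a)\sum_{m\ge1}\frac1m\sum_{k\ge1}\frac{\mu(k)}{k}\log L_{Aq}(\chi^k,km),$$ where $\chi_0$ is the principal character modulo $q$. -/

import Mathlib

open Filter Topology Asymptotics

noncomputable section

/-- The finite set of primes `p ≤ x`, for a real number `x`. -/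
def primesUpTo (x : ℝ) : Finset ℕ :=
  (Finset.Iic ⌊x⌋₊).filter Nat.Prime

/-- The partial Mertens product `P(x; q, a) = ∏_{p ≤ x, p ≡ a mod q} (1 - 1/p)`. -/
def mertensProd (q : ℕ) (a : ℤ) (x : ℝ) : ℝ :=
  ∏ p ∈ (primesUpTo x).filter (fun p : ℕ => (p : ℤ) ≡ a [ZMOD (q : ℤ)]), (1 - 1 / (p : ℝ))

/-- The constant `C(q, a)`, that is `lim_{x → ∞} P(x; q, a) (log x)^{1/φ(q)}`. -/
def mertensConst (q : ℕ) (a : ℤ) : ℝ :=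
  limUnder atTop
    (fun x : ℝ => mertensProd q a x * (Real.log x) ^ (1 / (Nat.totient q : ℝ)))

/-- The exponent `α(p; q, a)`: `φ(q) - 1` if `p ≡ a mod q`, and `-1` otherwise. -/
def mertensExp (q : ℕ) (a : ℤ) (p : ℕ) : ℤ :=
  if (p : ℤ) ≡ a [ZMOD (q : ℤ)] then (Nat.totient q : ℤ) - 1 else -1

/-- The partial Euler product `∏_{B < p ≤ N} (1 - χ(p) p^{-s})⁻¹`. -/
def eulerTailPartial {q : ℕ} (χ : DirichletCharacter ℂ q) (B : ℝ) (s : ℂ) (N : ℕ) : ℂ :=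
  ∏ p ∈ (Finset.Iic N).filter (fun p : ℕ => p.Prime ∧ B < (p : ℝ)),
    (1 - χ (p : ZMod q) / (p : ℂ) ^ s)⁻¹

/-- `L_B(χ, s) = ∏_{p > B} (1 - χ(p) p^{-s})⁻¹`, the limit of the partial products taken in
increasing order of `p` (the convergence is only conditional at `s = 1`). -/
def eulerTail {q : ℕ} (χ : DirichletCharacter ℂ q) (B : ℝ) (s : ℂ) : ℂ :=
  limUnder atTop (eulerTailPartial χ B s)

/-- The partial sum `-∑_{B < p ≤ N} Log (1 - χ(p) p^{-s})`, with principal logarithms. -/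
def logEulerTailPartial {q : ℕ} (χ : DirichletCharacter ℂ q) (B : ℝ) (s : ℂ) (N : ℕ) : ℂ :=
  -∑ p ∈ (Finset.Iic N).filter (fun p : ℕ => p.Prime ∧ B < (p : ℝ)),
    Complex.log (1 - χ (p : ZMod q) / (p : ℂ) ^ s)

/-- The logarithm `log L_B(χ, s) = -∑_{p > B} Log (1 - χ(p) p^{-s})` given by the Euler product.
It is the branch with `log L_B(χ, s) = ∑_{p > B} ∑_{j ≥ 1} χ(p)^j / (j p^{js})`. -/
def logEulerTail {q : ℕ} (χ : DirichletCharacter ℂ q) (B : ℝ) (s : ℂ) : ℂ :=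
  limUnder atTop (logEulerTailPartial χ B s)

/-- The term `(μ(k)/k) log L_B(χ^k, km)`. -/
def moebiusTerm {q : ℕ} (χ : DirichletCharacter ℂ q) (B : ℝ) (m k : ℕ+) : ℂ :=
  ((ArithmeticFunction.moebius (k : ℕ) : ℤ) : ℂ) / ((k : ℕ) : ℂ) *
    logEulerTail (χ ^ (k : ℕ)) B (((k : ℕ) * (m : ℕ) : ℕ) : ℂ)

end

/-! ### Abel's inequality and sums of non-principal characters -/

/-! Since `α(p) + 1` equals `φ(q)` or `0` according as `p ≡ a` or not, `φ(q) log P(x; q, a)` is the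
sum of `(α(p) + 1) log(1 - 1/p)` over `p ≤ x`. The part without `α` is `-log log x - γ + o(1)` by
Mertens' third theorem (`tendsto_sum_primes_neg_log_sub_log_log`). The part with `α` is cut at `B =
Aq`: the primes up to `B` give the finite product, and for `p > B`, where `p ∤ q`, orthogonality
gives `α(p) = ∑_{χ ≠ χ₀} conj χ(a) χ(p)` (`sum_conj_mul_eq_mertensExp`).

It remains to evaluate `∑_{p > B} χ(p) (-log(1 - 1/p)) = ∑_m (1/m) ∑_{p > B} χ(p) p^{-m}`. Möbius
inversion, `z = ∑_k (μ(k)/k) (-log(1 - z^k))` at `z = χ(p) p^{-m}`, turns the inner sum into `∑_k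
(μ(k)/k) log L_B(χ^k, km)`. The series are rearranged for finitely many primes `p ≤ N` only; then `N
→ ∞` under the sums over `k` and `m` by dominated convergence, with a bound `C 2^{-km}` uniform in
`N` (`exists_norm_logEulerTailPartial_le`).

Only `km = 1` converges conditionally. There `L(1, χ) ≠ 0` makes `∑ χ(n) Λ(n) / n` bounded, and
partial summation makes `∑ χ(p) / p` converge (`DirichletCharacter.exists_tendsto_sum_primes_div`).
The constant `γ` in Mertens' theorem comes from comparing `∑_{p ≤ e^τ} 1/p` with `∑_{n ≤ τ} 1/n`
through Laplace averages, and from the pole of `ζ` at `1`. -/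

theorem sum_smul_eq_sum_sub_smul {E : Type*} [AddCommGroup E] [Module ℝ E] (f : ℕ → ℝ) (z : ℕ → E)
    (n : ℕ) : ∑ i ∈ Finset.range n, f i • z i =
      f n • ∑ i ∈ Finset.range n, z i +
        ∑ i ∈ Finset.range n, (f i - f (i + 1)) • ∑ j ∈ Finset.range (i + 1), z j := by
  induction n with
  | zero => simp
  | succ n ih =>
    rw [Finset.sum_range_succ, ih, Finset.sum_range_succ (fun i => (f i - f (i + 1)) • _)]
    simp only [Finset.sum_range_succ z n, sub_smul, smul_add]
    abel

/-- **Abel's inequality**. -/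
theorem norm_sum_smul_le_of_antitone {E : Type*} [NormedAddCommGroup E] [NormedSpace ℝ E]
    {f : ℕ → ℝ} {z : ℕ → E} {b : ℝ} (hf : Antitone f) (hf0 : ∀ n, 0 ≤ f n)
    (hb : ∀ n, ‖∑ i ∈ Finset.range n, z i‖ ≤ b) (n : ℕ) :
    ‖∑ i ∈ Finset.range n, f i • z i‖ ≤ b * f 0 := by
  rw [sum_smul_eq_sum_sub_smul]
  calc _ ≤ f n * b + ∑ i ∈ Finset.range n, (f i - f (i + 1)) * b := by
        refine (norm_add_le _ _).trans (add_le_add ?_ ((norm_sum_le _ _).trans ?_))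
        · rw [norm_smul, Real.norm_of_nonneg (hf0 n)]
          exact mul_le_mul_of_nonneg_left (hb n) (hf0 n)
        · refine Finset.sum_le_sum fun i _ => ?_
          have h := sub_nonneg.2 (hf (Nat.le_succ i))
          rw [norm_smul, Real.norm_of_nonneg h]
          exact mul_le_mul_of_nonneg_left (hb _) h
    _ = b * f 0 := by
        rw [← Finset.sum_mul, Finset.sum_range_sub']
        ring

/-- The weights used with Abel's inequality decrease only from some index on, so bounds for blocks
not starting at `0` are needed. -/
theorem norm_sum_range_add_le {E : Type*} [NormedAddCommGroup E] {z : ℕ → E} {b : ℝ}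
    (hb : ∀ n, ‖∑ i ∈ Finset.range n, z i‖ ≤ b) (N n : ℕ) :
    ‖∑ i ∈ Finset.range n, z (N + i)‖ ≤ 2 * b := by
  have h := Finset.sum_range_add z N n
  rw [eq_sub_of_add_eq' h.symm, two_mul]
  exact (norm_sub_le _ _).trans (add_le_add (hb _) (hb _))

namespace DirichletCharacter

variable {q : ℕ} [NeZero q] {χ : DirichletCharacter ℂ q}

theorem sum_range_eq_zero_of_ne_one (hχ : χ ≠ 1) :
    ∑ n ∈ Finset.range q, χ (n : ZMod q) = 0 := by
  rw [← MulChar.sum_eq_zero_of_ne_one hχ]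
  refine Finset.sum_nbij' (fun n : ℕ => (n : ZMod q)) (fun a => a.val) ?_ ?_ ?_ ?_ ?_
  · simp
  · intro a _
    simpa using ZMod.val_lt a
  · intro n hn
    simpa using ZMod.val_cast_of_lt (Finset.mem_range.1 hn)
  · simp
  · simp

theorem norm_sum_range_le_of_ne_one (hχ : χ ≠ 1) (N : ℕ) :
    ‖∑ n ∈ Finset.range N, χ (n : ZMod q)‖ ≤ q := by
  induction N using Nat.strong_induction_on with
  | _ N ih =>
    rcases lt_or_ge N q with h | h
    · refine (norm_sum_le_of_le (Finset.range N) fun n _ => χ.norm_le_one (n : ZMod q)).trans ?_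
      simpa using h.le
    -- A full period sums to zero, so it can be removed.
    · obtain ⟨M, rfl⟩ := Nat.exists_eq_add_of_le h
      rw [Finset.sum_range_add, sum_range_eq_zero_of_ne_one hχ, zero_add]
      simpa using ih M (by have := NeZero.pos q; omega)

/-- The tail of the series `∑ χ(n) / n` of a non-principal character is `O(1 / N)`. -/
theorem norm_LFunction_one_sub_sum_le (hχ : χ ≠ 1) (N : ℕ) :
    ‖LFunction χ 1 - ∑ n ∈ Finset.range (N + 1), χ (n : ZMod q) / n‖ ≤ 2 * q / (N + 1) := by
  -- To the right of `1` the series converges absolutely, and Abel's inequality bounds its tail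
  -- uniformly in `σ`; letting `σ → 1+` and using continuity of `LFunction χ` then gives the bound
  -- at `1`.
  have key : ∀ σ : ℝ, 1 < σ →
      ‖LFunction χ σ - ∑ n ∈ Finset.range (N + 1), χ (n : ZMod q) / (n : ℂ) ^ (σ : ℂ)‖
        ≤ 2 * q / (N + 1) := by
    intro σ hσ
    have h1 : 1 < (σ : ℂ).re := by simpa using hσ
    have hσ0 : (σ : ℂ) ≠ 0 := by
      intro h
      norm_num [h] at h1
    have hs := (LSeriesSummable_of_one_lt_re χ h1).LSeriesHasSum
    rw [← LFunction_eq_LSeries χ h1] at hs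
    have ht : ∀ n : ℕ, LSeries.term (χ ·) σ n = χ (n : ZMod q) / (n : ℂ) ^ (σ : ℂ) :=
      fun n => by rw [LSeries.term_of_ne_zero' hσ0]
    have hlim := (hs.tendsto_sum_nat.comp (tendsto_add_atTop_nat (N + 1))).sub_const
      (∑ n ∈ Finset.range (N + 1), χ (n : ZMod q) / (n : ℂ) ^ (σ : ℂ))
    refine le_of_tendsto hlim.norm (Eventually.of_forall fun m => ?_)
    simp only [Function.comp_apply, ht]
    rw [add_comm m (N + 1), Finset.sum_range_add, add_sub_cancel_left]
    have hanti : Antitone fun i : ℕ => (((N + 1 + i : ℕ) : ℝ) ^ σ)⁻¹ := by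
      intro i j hij
      have : (0 : ℝ) < ((N + 1 + i : ℕ) : ℝ) := by positivity
      dsimp only
      gcongr
    have := norm_sum_smul_le_of_antitone hanti (fun n => by positivity)
      (norm_sum_range_add_le (norm_sum_range_le_of_ne_one hχ) (N + 1)) m
    refine le_trans (le_of_eq ?_) (this.trans ?_)
    · congr 1
      refine Finset.sum_congr rfl fun i _ => ?_
      rw [Complex.real_smul, div_eq_inv_mul, Complex.ofReal_inv, Complex.ofReal_cpow (by positivity),
        Complex.ofReal_natCast]
    · rw [← div_eq_mul_inv]
      gcongr
      have := Real.rpow_le_rpow_of_exponent_le (x := N + 1) (by simp) hσ.le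
      simpa using this
  have hc : Tendsto (fun σ : ℝ =>
      LFunction χ σ - ∑ n ∈ Finset.range (N + 1), χ (n : ZMod q) / (n : ℂ) ^ (σ : ℂ)) (𝓝[>] 1)
      (𝓝 (LFunction χ 1 - ∑ n ∈ Finset.range (N + 1), χ (n : ZMod q) / n)) := by
    have hcast : Tendsto (fun σ : ℝ => (σ : ℂ)) (𝓝[>] 1) (𝓝 1) := by
      have := Complex.continuous_ofReal.tendsto 1
      simpa using this.mono_left nhdsWithin_le_nhds
    refine (((differentiable_LFunction hχ).continuous.tendsto 1).comp hcast).sub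
      (tendsto_finsetSum _ fun n _ => ?_)
    rcases eq_or_ne n 0 with rfl | hn
    · have : (0 : ℂ) = χ ((0 : ℕ) : ZMod q) / ((0 : ℕ) : ℂ) := by simp
      rw [← this]
      refine tendsto_const_nhds.congr' ?_
      filter_upwards [self_mem_nhdsWithin] with σ hσ
      have : (σ : ℂ) ≠ 0 := by
        have : (0 : ℝ) < σ := lt_trans one_pos hσ
        exact_mod_cast this.ne'
      simp [Complex.zero_cpow this]
    · have hn' : (n : ℂ) ≠ 0 := by exact_mod_cast hn
      refine Tendsto.div tendsto_const_nhds ?_ hn'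
      have : NeZero (n : ℂ) := ⟨hn'⟩
      have := ((continuous_const_cpow (n : ℂ)).tendsto 1).comp hcast
      simpa [Function.comp_def] using this
  exact le_of_tendsto hc.norm (eventually_mem_nhdsWithin.mono fun σ hσ => key σ hσ)

end DirichletCharacter

/-! ### Mertens' first theorem, with and without a character -/

open scoped ArithmeticFunction.vonMangoldt Chebyshev

theorem exists_norm_le_of_shift {E : Type*} [NormedAddCommGroup E] {u : ℕ → E} (k : ℕ) {C : ℝ}
    (h : ∀ n, ‖u (k + n)‖ ≤ C) : ∃ C, ∀ n, ‖u n‖ ≤ C := by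
  refine ⟨C + ∑ i ∈ Finset.range k, ‖u i‖, fun n => ?_⟩
  have hC : 0 ≤ C := (norm_nonneg _).trans (h 0)
  rcases lt_or_ge n k with hn | hn
  · have := Finset.single_le_sum (f := fun i => ‖u i‖) (fun i _ => norm_nonneg _)
      (Finset.mem_range.2 hn)
    linarith
  · obtain ⟨m, rfl⟩ := Nat.exists_eq_add_of_le hn
    have : 0 ≤ ∑ i ∈ Finset.range k, ‖u i‖ := Finset.sum_nonneg fun i _ => norm_nonneg _
    linarith [h m]

theorem sum_Ioc_zero_eq_sum_range {M : Type*} [AddCommMonoid M] {f : ℕ → M} (h : f 0 = 0) (N : ℕ) :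
    ∑ n ∈ Finset.Ioc 0 N, f n = ∑ n ∈ Finset.range (N + 1), f n := by
  rw [Finset.sum_range_succ', h, add_zero,
    show Finset.Ioc 0 N = Finset.Ico 1 (N + 1) by ext; simp; omega, Finset.sum_Ico_eq_sum_range]
  simp [add_comm]

theorem natCast_div_le_div_add_one (N d : ℕ) : (N : ℝ) / d ≤ (N / d : ℕ) + 1 := by
  rw [← Nat.floor_div_eq_div (K := ℝ)]
  exact (Nat.lt_floor_add_one _).le

theorem sum_vonMangoldt_eq_psi (N : ℕ) : ∑ n ∈ Finset.Ioc 0 N, Λ n = ψ N := by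
  simp [Chebyshev.psi]

theorem sum_vonMangoldt_le (N : ℕ) : ∑ n ∈ Finset.Ioc 0 N, Λ n ≤ (Real.log 4 + 4) * N := by
  rw [sum_vonMangoldt_eq_psi]
  exact Chebyshev.psi_le_const_mul_self (Nat.cast_nonneg N)

/-- **Mertens' first theorem**. -/
theorem abs_sum_vonMangoldt_div_sub_log_le (N : ℕ) :
    |∑ n ∈ Finset.range (N + 1), Λ n / n - Real.log N| ≤ Real.log 4 + 4 := by
  rw [← sum_Ioc_zero_eq_sum_range (by simp)]
  have h4 : 0 ≤ Real.log 4 := Real.log_nonneg (by norm_num)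
  rcases Nat.eq_zero_or_pos N with rfl | hN
  · simp only [Finset.Ioc_self, Finset.sum_empty, Nat.cast_zero, Real.log_zero, sub_zero, abs_zero]
    linarith
  have hN' : (0 : ℝ) < N := by exact_mod_cast hN
  -- The convolution identity `Λ * 1 = log`, summed up to `N`. Replacing `⌊N/d⌋` by `N/d` costs at
  -- most `ψ(N) = O(N)`, and Stirling's bound evaluates the left side up to `O(N)`.
  have hfac : Real.log (N.factorial) = ∑ d ∈ Finset.Ioc 0 N, Λ d * ((N / d : ℕ) : ℝ) := by
    rw [← ArithmeticFunction.sum_Ioc_mul_zeta_eq_sum, ArithmeticFunction.vonMangoldt_mul_zeta,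
      sum_Ioc_zero_eq_sum_range (by simp), Finset.sum_range_succ', ← Finset.prod_range_add_one_eq_factorial,
      Nat.cast_prod, Real.log_prod fun i _ => by positivity]
    simp [ArithmeticFunction.log_apply]
  have hlow := Stirling.le_log_factorial_stirling hN.ne'
  have hupp : Real.log (N.factorial) ≤ N * Real.log N := by
    rw [← Real.log_pow]
    refine Real.log_le_log (by exact_mod_cast N.factorial_pos) ?_
    exact_mod_cast N.factorial_le_pow
  have h1 : ∑ d ∈ Finset.Ioc 0 N, Λ d * ((N / d : ℕ) : ℝ) ≤ N * ∑ n ∈ Finset.Ioc 0 N, Λ n / n := by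
    rw [Finset.mul_sum]
    refine Finset.sum_le_sum fun d _ => ?_
    calc Λ d * ((N / d : ℕ) : ℝ) ≤ Λ d * (N / d) :=
          mul_le_mul_of_nonneg_left Nat.cast_div_le ArithmeticFunction.vonMangoldt_nonneg
      _ = N * (Λ d / d) := by ring
  have h2 : N * ∑ n ∈ Finset.Ioc 0 N, Λ n / n ≤
      ∑ d ∈ Finset.Ioc 0 N, Λ d * ((N / d : ℕ) : ℝ) + ∑ d ∈ Finset.Ioc 0 N, Λ d := by
    rw [Finset.mul_sum, ← Finset.sum_add_distrib]
    refine Finset.sum_le_sum fun d _ => ?_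
    calc N * (Λ d / d) = Λ d * (N / d) := by ring
      _ ≤ Λ d * ((N / d : ℕ) + 1) :=
          mul_le_mul_of_nonneg_left (natCast_div_le_div_add_one N d) ArithmeticFunction.vonMangoldt_nonneg
      _ = _ := by ring
  have h3 := sum_vonMangoldt_le N
  rw [← hfac] at h1 h2
  have hlogN : 0 ≤ Real.log N := Real.log_natCast_nonneg N
  have hpi : 0 ≤ Real.log (2 * Real.pi) := Real.log_nonneg (by linarith [Real.pi_gt_three])
  rw [abs_le]
  constructor
  · refine le_of_mul_le_mul_left ?_ hN'
    nlinarith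
  · refine le_of_mul_le_mul_left ?_ hN'
    nlinarith

namespace DirichletCharacter

variable {q : ℕ} [NeZero q] {χ : DirichletCharacter ℂ q}

theorem exists_norm_sum_mul_log_div_le (hχ : χ ≠ 1) :
    ∃ C : ℝ, ∀ N : ℕ, ‖∑ n ∈ Finset.range N, χ (n : ZMod q) * Real.log n / n‖ ≤ C := by
  -- `log x / x` decreases only from `e` on, hence the start at `3`.
  have hanti : Antitone fun i : ℕ => Real.log ((3 + i : ℕ) : ℝ) / ((3 + i : ℕ) : ℝ) := by
    intro i j hij
    have h3 : ∀ i : ℕ, Real.exp 1 ≤ ((3 + i : ℕ) : ℝ) := fun i => by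
      push_cast
      linarith [Real.exp_one_lt_three, (Nat.cast_nonneg i : (0 : ℝ) ≤ i)]
    exact Real.log_div_self_antitoneOn (h3 i) (h3 j) (by exact_mod_cast Nat.add_le_add_left hij 3)
  have key := norm_sum_smul_le_of_antitone hanti
    (fun n => div_nonneg (Real.log_natCast_nonneg _) (Nat.cast_nonneg _))
    (norm_sum_range_add_le (norm_sum_range_le_of_ne_one hχ) 3)
  refine exists_norm_le_of_shift 3
    (C := ‖∑ n ∈ Finset.range 3, χ (n : ZMod q) * Real.log n / n‖ +
      2 * q * (Real.log ((3 + 0 : ℕ) : ℝ) / ((3 + 0 : ℕ) : ℝ))) fun n => ?_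
  rw [Finset.sum_range_add]
  refine (norm_add_le _ _).trans (add_le_add le_rfl (le_trans (le_of_eq ?_) (key n)))
  congr 1
  refine Finset.sum_congr rfl fun i _ => ?_
  rw [Complex.real_smul, Complex.ofReal_div, Complex.ofReal_natCast]
  ring

/-- Convolving `χΛ/n` with `χ/n` gives `χ log/n`, whose sums are bounded. Summing over the second
factor first, that factor contributes `L(1, χ)` up to a tail, so the wanted sum times `L(1, χ)` is
bounded; then `L(1, χ) ≠ 0` is used. -/
theorem exists_norm_sum_mul_vonMangoldt_div_le (hχ : χ ≠ 1) :
    ∃ C : ℝ, ∀ N : ℕ, ‖∑ n ∈ Finset.range N, χ (n : ZMod q) * (Λ n : ℂ) / n‖ ≤ C := by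
  obtain ⟨C, hC⟩ := exists_norm_sum_mul_log_div_le hχ
  have hL : 0 < ‖LFunction χ 1‖ := norm_pos_iff.2 (LFunction_apply_one_ne_zero hχ)
  refine exists_norm_le_of_shift 1 (C := (C + 2 * q * (Real.log 4 + 4)) / ‖LFunction χ 1‖)
    fun N => ?_
  rw [add_comm 1 N, ← sum_Ioc_zero_eq_sum_range (by simp)]
  let f : ArithmeticFunction ℂ := ⟨fun n => χ (n : ZMod q) * (Λ n : ℂ) / n, by simp⟩
  let g : ArithmeticFunction ℂ := ⟨fun n => χ (n : ZMod q) / n, by simp⟩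
  have hfg : ∀ n : ℕ, (f * g) n = χ (n : ZMod q) * Real.log n / n := by
    intro n
    rw [ArithmeticFunction.mul_apply, ← ArithmeticFunction.vonMangoldt_sum,
      ← Nat.sum_divisorsAntidiagonal (fun i _ => Λ i), Complex.ofReal_sum, Finset.mul_sum,
      Finset.sum_div]
    refine Finset.sum_congr rfl fun x hx => ?_
    rw [← (Nat.mem_divisorsAntidiagonal.1 hx).1]
    simp only [f, g, ArithmeticFunction.coe_mk, Nat.cast_mul, map_mul]
    rw [div_mul_div_comm]
    ring
  have hid := ArithmeticFunction.sum_Ioc_mul_eq_sum_sum f g N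
  obtain ⟨T, hT, hg⟩ : ∃ T : ℕ → ℂ, (∀ M, ‖T M‖ ≤ 2 * q / (M + 1)) ∧
      ∀ M : ℕ, ∑ m ∈ Finset.Ioc 0 M, g m = LFunction χ 1 - T M := by
    refine ⟨_, norm_LFunction_one_sub_sum_le hχ, fun M => ?_⟩
    rw [sub_sub_cancel, sum_Ioc_zero_eq_sum_range (by simp)]
    rfl
  simp only [hg, mul_sub, Finset.sum_sub_distrib, ← Finset.sum_mul] at hid
  rw [le_div_iff₀ hL, ← norm_mul]
  change ‖(∑ n ∈ Finset.Ioc 0 N, f n) * LFunction χ 1‖ ≤ _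
  rw [sub_eq_iff_eq_add.1 hid.symm]
  refine (norm_add_le _ _).trans (add_le_add ?_ ?_)
  · rw [Finset.sum_congr rfl fun n _ => hfg n, sum_Ioc_zero_eq_sum_range (by simp)]
    exact hC _
  · rcases Nat.eq_zero_or_pos N with rfl | hN
    · have : 0 ≤ Real.log 4 := Real.log_nonneg (by norm_num)
      simp only [Finset.Ioc_self, Finset.sum_empty, norm_zero]
      positivity
    have hN' : (0 : ℝ) < N := by exact_mod_cast hN
    -- The tail at `⌊N/d⌋` is at most `2qd/N`, which cancels the `1/d` in `f d`; Chebyshev's bound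
    -- then suffices.
    calc _ ≤ ∑ d ∈ Finset.Ioc 0 N, Λ d * (2 * q / N) := by
          refine norm_sum_le_of_le _ fun d hd => ?_
          have hd' : (0 : ℝ) < d := by exact_mod_cast (Finset.mem_Ioc.1 hd).1
          have hf : ‖f d‖ ≤ Λ d / d := by
            simp only [f, ArithmeticFunction.coe_mk]
            rw [norm_div, norm_mul, Complex.norm_natCast, Complex.norm_real,
              Real.norm_of_nonneg ArithmeticFunction.vonMangoldt_nonneg]
            gcongr
            exact mul_le_of_le_one_left ArithmeticFunction.vonMangoldt_nonneg (χ.norm_le_one _)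
          rw [norm_mul]
          refine (mul_le_mul hf (hT _) (norm_nonneg _)
            (div_nonneg ArithmeticFunction.vonMangoldt_nonneg hd'.le)).trans ?_
          rw [div_mul_eq_mul_div, mul_div_assoc]
          refine mul_le_mul_of_nonneg_left ?_ ArithmeticFunction.vonMangoldt_nonneg
          rw [div_div]
          gcongr
          have := natCast_div_le_div_add_one N d
          rwa [div_le_iff₀ hd'] at this
      _ ≤ (Real.log 4 + 4) * N * (2 * q / N) := by
          rw [← Finset.sum_mul]
          gcongr
          exact sum_vonMangoldt_le N
      _ = _ := by field_simp

end DirichletCharacter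

/-! ### Passing from prime powers to primes -/

theorem summable_vonMangoldt_non_primes_div :
    Summable fun n : ℕ => (if n.Prime then 0 else Λ n) / n := by
  have := ArithmeticFunction.vonMangoldt.summable_residueClass_non_primes_div (0 : ZMod 1)
  refine this.congr fun n => ?_
  congr 2
  simp [ArithmeticFunction.vonMangoldt.residueClass, Set.indicator, Subsingleton.elim _ (0 : ZMod 1)]

/-- Higher prime powers contribute an absolutely convergent series. `K` does not depend on `c`, so
it serves both for `c = χ` and for `c = 1`. -/
theorem exists_norm_sum_vonMangoldt_sub_sum_primes_le :
    ∃ K : ℝ, ∀ c : ℕ → ℂ, (∀ n, ‖c n‖ ≤ 1) → ∀ N : ℕ,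
      ‖∑ n ∈ Finset.range N, c n * (Λ n : ℂ) / n -
        ∑ n ∈ Finset.range N, if n.Prime then c n * Real.log n / n else 0‖ ≤ K := by
  refine ⟨∑' n : ℕ, (if n.Prime then 0 else Λ n) / n, fun c hc N => ?_⟩
  rw [← Finset.sum_sub_distrib]
  have hnn : ∀ n : ℕ, 0 ≤ (if n.Prime then 0 else Λ n) / (n : ℝ) := fun n => by
    split_ifs
    · simp
    · exact div_nonneg ArithmeticFunction.vonMangoldt_nonneg (Nat.cast_nonneg _)
  refine (norm_sum_le_of_le _ fun n _ => ?_).trans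
    (summable_vonMangoldt_non_primes_div.sum_le_tsum (Finset.range N) fun n _ => hnn n)
  split_ifs with hn
  · simp [ArithmeticFunction.vonMangoldt_apply_prime hn]
  · rw [sub_zero, norm_div, norm_mul, Complex.norm_natCast, Complex.norm_real,
      Real.norm_of_nonneg ArithmeticFunction.vonMangoldt_nonneg]
    gcongr
    exact mul_le_of_le_one_left ArithmeticFunction.vonMangoldt_nonneg (hc n)

/-- Dirichlet's test. The weight is monotone from `n = 2`; the terms at `0` and `1` vanish because
`(Real.log n)⁻¹ = 0` there. -/
theorem exists_tendsto_sum_inv_log_smul {E : Type*} [NormedAddCommGroup E] [NormedSpace ℝ E]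
    [CompleteSpace E] {z : ℕ → E} {b : ℝ} (hb : ∀ n, ‖∑ i ∈ Finset.range n, z i‖ ≤ b) :
    ∃ l, Tendsto (fun N => ∑ n ∈ Finset.range N, (Real.log n)⁻¹ • z n) atTop (𝓝 l) := by
  have hanti : Antitone fun i : ℕ => (Real.log ((2 + i : ℕ) : ℝ))⁻¹ := by
    intro i j hij
    have : 0 < Real.log ((2 + i : ℕ) : ℝ) := Real.log_pos (by push_cast; linarith [(Nat.cast_nonneg i : (0 : ℝ) ≤ i)])
    dsimp only
    gcongr
  have h0 : Tendsto (fun i : ℕ => (Real.log ((2 + i : ℕ) : ℝ))⁻¹) atTop (𝓝 0) := by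
    refine (Real.tendsto_log_atTop.comp (tendsto_natCast_atTop_atTop.comp ?_)).inv_tendsto_atTop
    exact tendsto_atTop_mono (fun n => Nat.le_add_left n 2) tendsto_id
  obtain ⟨l, hl⟩ := cauchySeq_tendsto_of_complete
    (hanti.cauchySeq_series_mul_of_tendsto_zero_of_bounded h0 (norm_sum_range_add_le hb 2))
  refine ⟨l, (tendsto_add_atTop_iff_nat 2).1 (hl.congr fun n => ?_)⟩
  rw [add_comm n 2, Finset.sum_range_add]
  simp [Finset.sum_range_succ]

theorem DirichletCharacter.exists_tendsto_sum_primes_div {q : ℕ} [NeZero q]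
    {χ : DirichletCharacter ℂ q} (hχ : χ ≠ 1) :
    ∃ l, Tendsto (fun N : ℕ => ∑ n ∈ Finset.range N, if n.Prime then χ (n : ZMod q) / n else 0)
      atTop (𝓝 l) := by
  obtain ⟨C, hC⟩ := exists_norm_sum_mul_vonMangoldt_div_le hχ
  obtain ⟨K, hK⟩ := exists_norm_sum_vonMangoldt_sub_sum_primes_le
  have hb : ∀ N, ‖∑ n ∈ Finset.range N,
      if n.Prime then χ (n : ZMod q) * Real.log n / n else 0‖ ≤ C + K := fun N => by
    have := norm_sub_le (∑ n ∈ Finset.range N, χ (n : ZMod q) * (Λ n : ℂ) / n) _ |>.trans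
      (add_le_add (hC N) (hK (fun n => χ (n : ZMod q)) (fun n => χ.norm_le_one _) N))
    rwa [sub_sub_cancel] at this
  obtain ⟨l, hl⟩ := exists_tendsto_sum_inv_log_smul hb
  refine ⟨l, hl.congr fun N => Finset.sum_congr rfl fun n _ => ?_⟩
  split_ifs with hn
  · have : (Real.log n : ℂ) ≠ 0 := by
      exact_mod_cast (Real.log_pos (by exact_mod_cast hn.one_lt)).ne'
    rw [Complex.real_smul, Complex.ofReal_inv]
    field_simp
  · simp

/-! ### Mertens' second theorem -/

theorem sum_range_succ_inv_eq_harmonic (N : ℕ) :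
    ∑ n ∈ Finset.range (N + 1), (n : ℝ)⁻¹ = harmonic N := by
  rw [Finset.sum_range_succ', harmonic]
  simp

theorem log_log_succ_sub_le {n : ℕ} (hn : 2 ≤ n) :
    Real.log (Real.log (n + 1)) - Real.log (Real.log n) ≤ (Real.log n)⁻¹ * (n : ℝ)⁻¹ := by
  have h2 : (2 : ℝ) ≤ n := by exact_mod_cast hn
  have h0 : 0 < Real.log n := Real.log_pos (by linarith)
  have h1 : 0 < Real.log (n + 1) := Real.log_pos (by linarith)
  have e1 := Real.log_le_sub_one_of_pos (div_pos h1 h0)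
  have e2 := Real.log_le_sub_one_of_pos (x := ((n : ℝ) + 1) / n) (by positivity)
  rw [Real.log_div (by positivity) (by positivity)] at e1 e2
  refine e1.trans ?_
  rw [div_sub_one h0.ne', div_eq_inv_mul]
  gcongr
  refine e2.trans (le_of_eq ?_)
  field_simp
  ring

theorem le_log_log_succ_sub {n : ℕ} (hn : 2 ≤ n) :
    (Real.log (n + 1))⁻¹ * ((n : ℝ) + 1)⁻¹ ≤ Real.log (Real.log (n + 1)) - Real.log (Real.log n) := by
  have h2 : (2 : ℝ) ≤ n := by exact_mod_cast hn
  have h0 : 0 < Real.log n := Real.log_pos (by linarith)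
  have h1 : 0 < Real.log (n + 1) := Real.log_pos (by linarith)
  have e1 := Real.one_sub_inv_le_log_of_pos (div_pos h1 h0)
  have e2 := Real.one_sub_inv_le_log_of_pos (x := ((n : ℝ) + 1) / n) (by positivity)
  rw [Real.log_div (by positivity) (by positivity), inv_div] at e1 e2
  refine le_trans ?_ e1
  rw [one_sub_div h1.ne', div_eq_inv_mul]
  gcongr
  refine le_trans (le_of_eq ?_) e2
  field_simp
  ring

theorem exists_tendsto_sum_inv_log_mul_inv_sub_log_log :
    ∃ l : ℝ, Tendsto (fun N : ℕ => ∑ n ∈ Finset.range N, (Real.log n)⁻¹ * (n : ℝ)⁻¹ -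
      Real.log (Real.log N)) atTop (𝓝 l) := by
  -- From index `2` on `u` increases, `v` decreases and `u ≤ v`, by the two comparisons of `1 / (n
  -- log n)` with increments of `log log`.
  let u : ℕ → ℝ := fun N => ∑ n ∈ Finset.range N, (Real.log n)⁻¹ * (n : ℝ)⁻¹ - Real.log (Real.log N)
  let v : ℕ → ℝ := fun N => u N + (Real.log N)⁻¹ * (N : ℝ)⁻¹
  have hu : Monotone fun n => u (n + 2) := monotone_nat_of_le_succ fun n => by
    have := log_log_succ_sub_le (n := n + 2) (by omega)
    simp only [u]
    rw [show n + 1 + 2 = (n + 2) + 1 by ring, Finset.sum_range_succ _ (n + 2), Nat.cast_succ (n + 2)]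
    linarith
  have hv : Antitone fun n => v (n + 2) := antitone_nat_of_succ_le fun n => by
    have := le_log_log_succ_sub (n := n + 2) (by omega)
    simp only [u, v]
    rw [show n + 1 + 2 = (n + 2) + 1 by ring, Finset.sum_range_succ _ (n + 2), Nat.cast_succ (n + 2)]
    linarith
  have hbdd : BddAbove (Set.range fun n => u (n + 2)) := by
    refine ⟨v 2, ?_⟩
    rintro _ ⟨n, rfl⟩
    refine le_trans ?_ (hv (Nat.zero_le n))
    have : 0 ≤ (Real.log (n + 2 : ℕ))⁻¹ * ((n + 2 : ℕ) : ℝ)⁻¹ :=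
      mul_nonneg (inv_nonneg.2 (Real.log_natCast_nonneg _)) (by positivity)
    simp only [v]
    linarith
  exact ⟨_, (tendsto_add_atTop_iff_nat 2).1 (tendsto_atTop_ciSup hu hbdd)⟩

/-- **Mertens' second theorem**, with an unspecified constant. -/
theorem exists_tendsto_sum_primes_inv_sub_log_log :
    ∃ M : ℝ, Tendsto (fun N : ℕ => ∑ n ∈ Finset.range N, (if n.Prime then (n : ℝ)⁻¹ else 0) -
      Real.log (Real.log N)) atTop (𝓝 M) := by
  obtain ⟨K, hK⟩ := exists_norm_sum_vonMangoldt_sub_sum_primes_le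
  -- Subtracting `1/n` cancels the main term `log N` of Mertens' first theorem. Division by `log n`
  -- turns `z` into `1/p` minus `1 / (n log n)`, and the latter sums to `log log N` plus a constant.
  let z : ℕ → ℝ := fun n => (if n.Prime then Real.log n / n else 0) - (n : ℝ)⁻¹
  have hz : ∃ b, ∀ N, ‖∑ n ∈ Finset.range N, z n‖ ≤ b := by
    refine exists_norm_le_of_shift 1 (C := K + (Real.log 4 + 4) + 1) fun N => ?_
    rw [add_comm 1 N]
    have h1 := hK (fun _ => 1) (by simp) (N + 1)
    have h2 := abs_sum_vonMangoldt_div_sub_log_le N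
    have h3 : |Real.log N - ∑ n ∈ Finset.range (N + 1), (n : ℝ)⁻¹| ≤ 1 := by
      rw [sum_range_succ_inv_eq_harmonic, abs_le]
      have := log_add_one_le_harmonic N
      have := harmonic_le_one_add_log N
      have : Real.log N ≤ Real.log (N + 1 : ℕ) := by
        rcases Nat.eq_zero_or_pos N with rfl | hN
        · simp
        · exact Real.log_le_log (by exact_mod_cast hN) (by exact_mod_cast N.le_succ)
      constructor <;> linarith
    have h1' : |∑ n ∈ Finset.range (N + 1), Λ n / n -
        ∑ n ∈ Finset.range (N + 1), if n.Prime then Real.log n / n else 0| ≤ K := by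
      rw [← Real.norm_eq_abs, ← Complex.norm_real]
      convert h1 using 2
      push_cast
      congr 1
      · simp
      · refine Finset.sum_congr rfl fun n _ => ?_
        split_ifs <;> simp
    rw [Finset.sum_sub_distrib, Real.norm_eq_abs]
    rw [abs_le] at *
    constructor <;> linarith
  obtain ⟨b, hb⟩ := hz
  obtain ⟨l, hl⟩ := exists_tendsto_sum_inv_log_smul hb
  obtain ⟨l', hl'⟩ := exists_tendsto_sum_inv_log_mul_inv_sub_log_log
  refine ⟨l + l', (hl.add hl').congr fun N => ?_⟩
  rw [← add_sub_assoc, ← Finset.sum_add_distrib]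
  congr 1
  refine Finset.sum_congr rfl fun n _ => ?_
  simp only [z, smul_eq_mul]
  split_ifs with hn
  · have : Real.log n ≠ 0 := (Real.log_pos (by exact_mod_cast hn.one_lt)).ne'
    field_simp
    ring
  · ring

/-! ### Abelian theorems for Laplace averages -/

open MeasureTheory in
/-- If `F` counts points `t n` with weights `b n`, then
`δ ∫ F(τ) e^{-δτ} dτ = ∑ b n e^{-δ t n}`. -/
theorem laplace_counting_function {b t : ℕ → ℝ} (hb : ∀ n, 0 ≤ b n) (hb' : ∃ n, 0 < b n)
    (ht : ∀ n, 0 ≤ t n) {F : ℝ → ℝ}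
    (hF : ∀ τ, 0 < τ → HasSum (fun n => if t n ≤ τ then b n else 0) (F τ)) {δ : ℝ} (hδ : 0 < δ)
    (hs : Summable fun n => b n * Real.exp (-δ * t n)) :
    IntegrableOn (fun τ => F τ * Real.exp (-δ * τ)) (Set.Ioi 0) ∧
      δ * ∫ τ in Set.Ioi 0, F τ * Real.exp (-δ * τ) = ∑' n, b n * Real.exp (-δ * t n) := by
  have hδ' : -δ < 0 := by linarith
  let f : ℕ → ℝ → ℝ := fun n => (Set.Ici (t n)).indicator fun τ => b n * Real.exp (-δ * τ)
  have hf : ∀ n, Integrable (f n) (volume.restrict (Set.Ioi 0)) := fun n => by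
    refine (Integrable.const_mul ?_ (b n)).indicator measurableSet_Ici
    exact integrableOn_exp_mul_Ioi hδ' 0
  have hint : ∀ n, ∫ τ in Set.Ioi 0, f n τ = b n * Real.exp (-δ * t n) / δ := fun n => by
    have h1 : ∫ τ in Set.Ioi 0, f n τ = ∫ τ in Set.Ici (t n), b n * Real.exp (-δ * τ) := by
      rw [← integral_Ici_eq_integral_Ioi, setIntegral_indicator measurableSet_Ici,
        Set.Ici_inter_Ici, sup_of_le_right (ht n)]
    rw [h1, integral_const_mul, integral_Ici_eq_integral_Ioi, integral_exp_mul_Ioi hδ']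
    field_simp
  have hnorm : ∀ n, ∫ τ in Set.Ioi 0, ‖f n τ‖ = b n * Real.exp (-δ * t n) / δ := fun n => by
    rw [← hint]
    congr 1
    ext τ
    refine Real.norm_of_nonneg (Set.indicator_nonneg (fun τ _ => ?_) τ)
    exact mul_nonneg (hb n) (Real.exp_pos _).le
  have key := hasSum_integral_of_summable_integral_norm hf
    (by simpa only [hnorm] using hs.div_const δ)
  simp only [hint] at key
  have hF' : ∫ τ in Set.Ioi 0, ∑' n, f n τ = ∫ τ in Set.Ioi 0, F τ * Real.exp (-δ * τ) := by
    refine setIntegral_congr_fun measurableSet_Ioi fun τ hτ => ?_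
    have := ((hF τ hτ).mul_right (Real.exp (-δ * τ))).tsum_eq
    simp only [ite_mul, zero_mul] at this
    exact this
  rw [hF'] at key
  have heq : δ * ∫ τ in Set.Ioi 0, F τ * Real.exp (-δ * τ) = ∑' n, b n * Real.exp (-δ * t n) := by
    rw [← key.tsum_eq, tsum_div_const]
    field_simp
  refine ⟨?_, heq⟩
  -- A non-integrable function would have integral `0` by convention, while the series is positive
  -- by `hb'`.
  by_contra h
  rw [IntegrableOn] at h
  rw [integral_undef h, mul_zero] at heq
  obtain ⟨n, hn⟩ := hb'
  have := hs.tsum_pos (fun n => mul_nonneg (hb n) (Real.exp_pos _).le) n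
    (mul_pos hn (Real.exp_pos _))
  linarith

open MeasureTheory in
theorem tendsto_laplace_average {D : ℝ → ℝ} {C l : ℝ} (hC : ∀ τ, 0 < τ → |D τ| ≤ C)
    (hD : Tendsto D atTop (𝓝 l)) (hmeas : Measurable D) :
    Tendsto (fun δ : ℝ => δ * ∫ τ in Set.Ioi 0, D τ * Real.exp (-δ * τ)) (𝓝[>] 0) (𝓝 l) := by
  -- Substitution `u = δτ`: for fixed `u > 0` the argument `u / δ` tends to infinity, and `C e^{-u}`
  -- dominates.
  have h1 : Tendsto (fun δ : ℝ => ∫ u in Set.Ioi (0 : ℝ), D (u / δ) * Real.exp (-u)) (𝓝[>] 0)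
      (𝓝 (∫ u in Set.Ioi (0 : ℝ), l * Real.exp (-u))) := by
    refine tendsto_integral_filter_of_dominated_convergence (fun u => C * Real.exp (-u)) ?_ ?_ ?_ ?_
    · refine Eventually.of_forall fun δ => Measurable.aestronglyMeasurable ?_
      exact (hmeas.comp (measurable_id.div_const δ)).mul (Real.measurable_exp.comp measurable_neg)
    · filter_upwards [self_mem_nhdsWithin] with δ hδ
      filter_upwards [ae_restrict_mem measurableSet_Ioi] with u hu
      rw [norm_mul, Real.norm_eq_abs, Real.norm_of_nonneg (Real.exp_pos _).le]
      exact mul_le_mul_of_nonneg_right (hC _ (div_pos hu hδ)) (Real.exp_pos _).le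
    · have := exp_neg_integrableOn_Ioi 0 one_pos
      simp only [neg_mul, one_mul] at this
      exact this.const_mul C
    · filter_upwards [ae_restrict_mem measurableSet_Ioi] with u hu
      have hu' : Tendsto (fun δ : ℝ => u / δ) (𝓝[>] 0) atTop :=
        tendsto_inv_nhdsGT_zero.const_mul_atTop hu
      exact (hD.comp hu').mul_const _
  rw [integral_const_mul, integral_exp_neg_Ioi_zero, mul_one] at h1
  refine h1.congr' ?_
  filter_upwards [self_mem_nhdsWithin] with δ hδ
  have hδ' : (0 : ℝ) < δ := hδ
  have := integral_comp_mul_left_Ioi (fun u => D (u / δ) * Real.exp (-u)) 0 hδ'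
  rw [mul_zero, smul_eq_mul] at this
  rw [show ∫ τ in Set.Ioi 0, D τ * Real.exp (-δ * τ) =
    ∫ x in Set.Ioi (0 : ℝ), D (δ * x / δ) * Real.exp (-(δ * x)) from ?_, this,
    mul_inv_cancel_left₀ hδ'.ne']
  congr 1
  ext x
  rw [mul_div_cancel_left₀ _ hδ'.ne', neg_mul]

open MeasureTheory in
/-- Comparison of two weighted counting functions gives comparison of their Laplace averages. -/
theorem tendsto_sub_of_tendsto_counting_sub {b c s t : ℕ → ℝ} (hb : ∀ n, 0 ≤ b n)
    (hb' : ∃ n, 0 < b n) (hc : ∀ n, 0 ≤ c n) (hc' : ∃ n, 0 < c n) (hs : ∀ n, 0 ≤ s n)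
    (ht : ∀ n, 0 ≤ t n) {F G : ℝ → ℝ} (hFm : Monotone F) (hGm : Monotone G)
    (hF : ∀ τ, 0 < τ → HasSum (fun n => if s n ≤ τ then b n else 0) (F τ))
    (hG : ∀ τ, 0 < τ → HasSum (fun n => if t n ≤ τ then c n else 0) (G τ))
    (hbs : ∀ δ, 0 < δ → Summable fun n => b n * Real.exp (-δ * s n))
    (hct : ∀ δ, 0 < δ → Summable fun n => c n * Real.exp (-δ * t n)) {l : ℝ}
    (hl : Tendsto (fun τ => F τ - G τ) atTop (𝓝 l)) :
    Tendsto (fun δ => ∑' n, b n * Real.exp (-δ * s n) - ∑' n, c n * Real.exp (-δ * t n))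
      (𝓝[>] 0) (𝓝 l) := by
  obtain ⟨T, hT⟩ := eventually_atTop.1 (hl.abs.eventually_le_const (lt_add_one |l|))
  -- Beyond `T` convergence bounds the difference; up to `T` monotonicity bounds `F` and `G`
  -- separately by their values at `0` and `T`.
  have hbdd : ∀ τ, 0 < τ → |F τ - G τ| ≤ |l| + 1 + (|F 0| + |F T| + (|G 0| + |G T|)) := by
    intro τ hτ
    rcases le_total T τ with h | h
    · refine (hT τ h).trans ?_
      have : 0 ≤ |F 0| + |F T| + (|G 0| + |G T|) := by positivity
      linarith
    · have hm : ∀ H : ℝ → ℝ, Monotone H → |H τ| ≤ |H 0| + |H T| := fun H hH => by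
        have h1 := hH hτ.le
        have h2 := hH h
        rw [abs_le]
        constructor
        · linarith [neg_abs_le (H 0), abs_nonneg (H T)]
        · linarith [le_abs_self (H T), abs_nonneg (H 0)]
      have := abs_sub (F τ) (G τ)
      have := hm F hFm
      have := hm G hGm
      have := abs_nonneg l
      linarith
  refine (tendsto_laplace_average hbdd hl (hFm.measurable.sub hGm.measurable)).congr' ?_
  filter_upwards [self_mem_nhdsWithin] with δ hδ
  obtain ⟨i1, e1⟩ := laplace_counting_function hb hb' hs hF hδ (hbs δ hδ)
  obtain ⟨i2, e2⟩ := laplace_counting_function hc hc' ht hG hδ (hct δ hδ)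
  rw [← e1, ← e2, ← mul_sub, ← integral_sub i1 i2]
  simp only [sub_mul]

/-! ### The constant in Mertens' theorem -/

theorem tendsto_natFloor_add_one_div_atTop :
    Tendsto (fun x : ℝ => ((⌊x⌋₊ + 1 : ℕ) : ℝ) / x) atTop (𝓝 1) := by
  have := (tendsto_nat_floor_div_atTop (R := ℝ)).add tendsto_inv_atTop_zero
  rw [add_zero] at this
  refine this.congr fun x => ?_
  push_cast
  rw [add_div, one_div]

/-- Carries asymptotics from integers to real `x`; the sum over `p ≤ x` is a sum over `range (⌊x⌋₊ +
1)`, hence the shift by one. -/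
theorem tendsto_log_log_floor_sub_log_log :
    Tendsto (fun x : ℝ => Real.log (Real.log (⌊x⌋₊ + 1 : ℕ)) - Real.log (Real.log x)) atTop
      (𝓝 0) := by
  have h1 : Tendsto (fun x : ℝ => Real.log (((⌊x⌋₊ + 1 : ℕ) : ℝ) / x)) atTop (𝓝 0) := by
    have := (Real.continuousAt_log one_ne_zero).tendsto.comp tendsto_natFloor_add_one_div_atTop
    rwa [Real.log_one] at this
  have h2 : Tendsto (fun x : ℝ => Real.log (((⌊x⌋₊ + 1 : ℕ) : ℝ) / x) / Real.log x + 1) atTop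
      (𝓝 1) := by
    have := (h1.div_atTop Real.tendsto_log_atTop).add_const 1
    rwa [zero_add] at this
  have h3 := (Real.continuousAt_log one_ne_zero).tendsto.comp h2
  rw [Real.log_one] at h3
  refine h3.congr' ?_
  filter_upwards [eventually_gt_atTop 1] with x hx
  have hl : 0 < Real.log x := Real.log_pos hx
  have hx' : x < ((⌊x⌋₊ + 1 : ℕ) : ℝ) := by
    push_cast
    exact Nat.lt_floor_add_one x
  have hl' : 0 < Real.log (⌊x⌋₊ + 1 : ℕ) := Real.log_pos (hx.trans hx')
  rw [← Real.log_div hl'.ne' hl.ne', Function.comp_apply,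
    Real.log_div (by linarith) (by linarith)]
  congr 1
  field_simp
  ring

theorem tendsto_harmonic_floor_sub_log :
    Tendsto (fun x : ℝ => (harmonic ⌊x⌋₊ : ℝ) - Real.log x) atTop
      (𝓝 Real.eulerMascheroniConstant) := by
  have h1 : Tendsto (fun x : ℝ => Real.log (((⌊x⌋₊ + 1 : ℕ) : ℝ) / x)) atTop (𝓝 0) := by
    have := (Real.continuousAt_log one_ne_zero).tendsto.comp tendsto_natFloor_add_one_div_atTop
    rwa [Real.log_one] at this
  have h2 := (Real.tendsto_harmonic_sub_log_add_one.comp (tendsto_nat_floor_atTop (α := ℝ))).add h1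
  rw [add_zero] at h2
  refine h2.congr' ?_
  filter_upwards [eventually_gt_atTop 0] with x hx
  rw [Real.log_div (by positivity) hx.ne', Function.comp_apply]
  push_cast
  ring

/-- `∑_p p^{-1-δ} + log(1 - e^{-δ}) → M - γ` as `δ → 0+`. -/
theorem tendsto_sum_primes_rpow_add_log {M : ℝ}
    (hM : Tendsto (fun N : ℕ => ∑ n ∈ Finset.range N, (if n.Prime then (n : ℝ)⁻¹ else 0) -
      Real.log (Real.log N)) atTop (𝓝 M)) :
    Tendsto (fun δ : ℝ => ∑' n : ℕ, (if n.Prime then (n : ℝ) ^ (-(1 + δ)) else 0) +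
      Real.log (1 - Real.exp (-δ))) (𝓝[>] 0) (𝓝 (M - Real.eulerMascheroniConstant)) := by
  let b : ℕ → ℝ := fun n => if n.Prime then (n : ℝ)⁻¹ else 0
  have hb0 : ∀ n, 0 ≤ b n := fun n => by
    simp only [b]
    split_ifs <;> positivity
  let F : ℝ → ℝ := fun τ => ∑ n ∈ Finset.range (⌊Real.exp τ⌋₊ + 1), b n
  let G : ℝ → ℝ := fun τ => (harmonic ⌊τ⌋₊ : ℝ)
  have hG' : ∀ τ, G τ = ∑ n ∈ Finset.range ⌊τ⌋₊, ((n : ℝ) + 1)⁻¹ := fun τ => by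
    simp [G, harmonic]
  have hbexp : ∀ δ : ℝ, ∀ n : ℕ, b n * Real.exp (-δ * Real.log n) =
      if n.Prime then (n : ℝ) ^ (-(1 + δ)) else 0 := fun δ n => by
    simp only [b, ite_mul, zero_mul]
    refine if_ctx_congr Iff.rfl (fun hn => ?_) fun _ => rfl
    have hn' : (0 : ℝ) < n := by exact_mod_cast hn.pos
    rw [Real.rpow_def_of_pos hn', ← Real.exp_log (inv_pos.2 hn'), ← Real.exp_add, Real.log_inv]
    ring_nf
  have hcexp : ∀ δ : ℝ, 0 < δ →
      HasSum (fun n : ℕ => ((n : ℝ) + 1)⁻¹ * Real.exp (-δ * ((n : ℝ) + 1)))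
        (-Real.log (1 - Real.exp (-δ))) := fun δ hδ => by
    have := Real.hasSum_pow_div_log_of_abs_lt_one (x := Real.exp (-δ))
      (by rw [abs_of_pos (Real.exp_pos _), Real.exp_lt_one_iff]; linarith)
    refine this.congr_fun fun n => ?_
    rw [← Real.exp_nat_mul]
    push_cast
    ring_nf
  -- Weights `1/p` at the points `log p` against weights `1/n` at the points `n ≥ 1`. The counting
  -- functions are `log τ + M + o(1)` and `log τ + γ + o(1)`; the exponential sums are `∑ p^{-1-δ}`
  -- and `-log(1 - e^{-δ})`.
  have key := tendsto_sub_of_tendsto_counting_sub (b := b) (c := fun n => ((n : ℝ) + 1)⁻¹)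
    (s := fun n => Real.log n) (t := fun n => (n : ℝ) + 1) (F := F) (G := G) hb0
    ⟨2, by simp [b, Nat.prime_two]⟩ (fun n => by positivity) ⟨0, by simp⟩
    (fun n => Real.log_natCast_nonneg n) (fun n => by positivity) ?_ ?_ ?_ ?_ ?_ ?_
    (l := M - Real.eulerMascheroniConstant) ?_
  · refine key.congr' ?_
    filter_upwards [self_mem_nhdsWithin] with δ hδ
    rw [(hcexp δ hδ).tsum_eq, sub_neg_eq_add]
    simp only [hbexp]
  · intro x y hxy
    refine Finset.sum_le_sum_of_subset_of_nonneg ?_ fun n _ _ => hb0 n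
    have : ⌊Real.exp x⌋₊ ≤ ⌊Real.exp y⌋₊ := Nat.floor_mono (Real.exp_le_exp.2 hxy)
    simpa using this
  · intro x y hxy
    simp only [hG']
    refine Finset.sum_le_sum_of_subset_of_nonneg ?_ fun n _ _ => by positivity
    simpa using Nat.floor_mono hxy
  · intro τ hτ
    have := hasSum_sum_of_ne_finset_zero (L := SummationFilter.unconditional ℕ)
      (f := fun n : ℕ => if Real.log n ≤ τ then b n else 0)
      (s := Finset.range (⌊Real.exp τ⌋₊ + 1)) fun n hn => ?_
    · convert this using 1
      refine Finset.sum_congr rfl fun n hn => ?_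
      rw [if_pos]
      rcases Nat.eq_zero_or_pos n with rfl | hn0
      · simpa using hτ.le
      · rw [Real.log_le_iff_le_exp (by exact_mod_cast hn0)]
        exact (Nat.le_floor_iff (Real.exp_pos τ).le).1 (Nat.lt_succ_iff.1 (Finset.mem_range.1 hn))
    · rw [if_neg]
      rw [Finset.mem_range, not_lt, Nat.succ_le_iff, Nat.floor_lt (Real.exp_pos τ).le] at hn
      rw [not_le, Real.lt_log_iff_exp_lt ((Real.exp_pos τ).trans hn)]
      exact hn
  · intro τ hτ
    rw [hG']
    have := hasSum_sum_of_ne_finset_zero (L := SummationFilter.unconditional ℕ)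
      (f := fun n : ℕ => if (n : ℝ) + 1 ≤ τ then ((n : ℝ) + 1)⁻¹ else 0)
      (s := Finset.range ⌊τ⌋₊) fun n hn => ?_
    · convert this using 1
      refine Finset.sum_congr rfl fun n hn => ?_
      rw [if_pos]
      exact_mod_cast (Nat.le_floor_iff hτ.le).1 (Nat.succ_le_iff.2 (Finset.mem_range.1 hn))
    · rw [if_neg]
      rw [Finset.mem_range, not_lt, ← Nat.lt_succ_iff, Nat.floor_lt hτ.le] at hn
      rw [not_le]
      exact_mod_cast hn
  · intro δ hδ
    simp only [hbexp]
    refine Summable.of_nonneg_of_le (fun n => ?_) (fun n => ?_)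
      (Real.summable_nat_rpow.2 (show -(1 + δ) < -1 by linarith))
    · split_ifs <;> positivity
    · split_ifs
      · rfl
      · positivity
  · exact fun δ hδ => (hcexp δ hδ).summable
  · have h1 := hM.comp ((tendsto_add_atTop_nat 1).comp
      ((tendsto_nat_floor_atTop (α := ℝ)).comp Real.tendsto_exp_atTop))
    have h2 := tendsto_log_log_floor_sub_log_log.comp Real.tendsto_exp_atTop
    have h3 := (h1.add h2).sub tendsto_harmonic_floor_sub_log
    rw [add_zero] at h3
    refine h3.congr fun τ => ?_
    simp only [Function.comp_apply, F, G, b, Real.log_exp]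
    ring

theorem abs_neg_log_one_sub_sub_le {x : ℝ} (hx : 0 ≤ x) (hx' : x ≤ 1 / 2) :
    |-Real.log (1 - x) - x| ≤ 2 * x ^ 2 := by
  have := Real.abs_log_sub_add_sum_range_le (x := x) (by rw [abs_of_nonneg hx]; linarith) 1
  rw [abs_of_nonneg hx] at this
  rw [← abs_neg]
  refine le_trans (le_of_eq ?_) (this.trans ?_)
  · simp
  · rw [div_le_iff₀ (by linarith), one_add_one_eq_two]
    nlinarith [mul_nonneg (sq_nonneg x) (show 0 ≤ 1 - 2 * x by linarith)]

theorem rpow_neg_one_add_le_inv {p : ℕ} (hp : p.Prime) {δ : ℝ} (hδ : 0 < δ) :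
    (p : ℝ) ^ (-(1 + δ)) ≤ (p : ℝ)⁻¹ := by
  rw [← Real.rpow_neg_one]
  exact Real.rpow_le_rpow_of_exponent_le (by exact_mod_cast hp.one_le) (by linarith)

theorem Nat.Prime.cast_inv_le_half {p : ℕ} (hp : p.Prime) : (p : ℝ)⁻¹ ≤ 1 / 2 := by
  rw [one_div]
  exact inv_anti₀ two_pos (by exact_mod_cast hp.two_le)

theorem summable_two_mul_inv_sq : Summable fun n : ℕ => 2 * ((n : ℝ)⁻¹) ^ 2 := by
  have := (Real.summable_nat_pow_inv (p := 2)).2 one_lt_two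
  simpa only [inv_pow] using this.mul_left 2

/-- The terms are at most `2 p^{-2}` uniformly in `δ`, so the limit passes inside. This is the
difference between `log ζ(1 + δ)` and `∑ p^{-1-δ}`. -/
theorem tendsto_sum_primes_log_sub :
    Tendsto (fun δ : ℝ => ∑' n : ℕ, if n.Prime then
      -Real.log (1 - (n : ℝ) ^ (-(1 + δ))) - (n : ℝ) ^ (-(1 + δ)) else 0) (𝓝[>] 0)
      (𝓝 (∑' n : ℕ, if n.Prime then -Real.log (1 - (n : ℝ)⁻¹) - (n : ℝ)⁻¹ else 0)) := by
  refine tendsto_tsum_of_dominated_convergence summable_two_mul_inv_sq (fun n => ?_) ?_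
  · split_ifs with hn
    · have hn0 : (0 : ℝ) < n := by exact_mod_cast hn.pos
      have h1 : Tendsto (fun δ : ℝ => (n : ℝ) ^ (-(1 + δ))) (𝓝[>] 0) (𝓝 (n : ℝ)⁻¹) := by
        rw [← Real.rpow_neg_one]
        refine tendsto_nhdsWithin_of_tendsto_nhds ?_
        have : Continuous fun δ : ℝ => (n : ℝ) ^ (-(1 + δ)) :=
          Real.continuous_const_rpow hn0.ne' |>.comp (by fun_prop)
        simpa using this.tendsto 0
      refine ((h1.const_sub 1).log ?_).neg.sub h1
      linarith [hn.cast_inv_le_half]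
    · exact tendsto_const_nhds
  · filter_upwards [self_mem_nhdsWithin] with δ hδ n
    split_ifs with hn
    · have h1 := rpow_neg_one_add_le_inv hn hδ
      have h0 : 0 ≤ (n : ℝ) ^ (-(1 + δ)) := by positivity
      rw [Real.norm_eq_abs]
      refine (abs_neg_log_one_sub_sub_le h0 (h1.trans hn.cast_inv_le_half)).trans ?_
      gcongr
    · simp only [norm_zero]
      positivity

theorem log_riemannZeta_eq_tsum_primes {δ : ℝ} (hδ : 0 < δ) :
    Real.log (riemannZeta ((1 + δ : ℝ) : ℂ)).re =
      ∑' n : ℕ, if n.Prime then -Real.log (1 - (n : ℝ) ^ (-(1 + δ))) else 0 := by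
  rw [← riemannZeta_eulerProduct_exp_log (by simpa using hδ)]
  have : ∑' p : Nat.Primes, -Complex.log (1 - (p : ℂ) ^ (-((1 + δ : ℝ) : ℂ))) =
      ((∑' p : Nat.Primes, -Real.log (1 - ((p : ℕ) : ℝ) ^ (-(1 + δ))) : ℝ) : ℂ) := by
    rw [Complex.ofReal_tsum]
    refine tsum_congr fun p => ?_
    have h1 := (rpow_neg_one_add_le_inv p.2 hδ).trans p.2.cast_inv_le_half
    rw [Complex.ofReal_neg, Complex.ofReal_log (by linarith), Complex.ofReal_sub,
      Complex.ofReal_cpow (Nat.cast_nonneg _)]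
    simp
  rw [this, Complex.exp_ofReal_re, Real.log_exp]
  have h2 := tsum_subtype {p : ℕ | p.Prime} fun n : ℕ => -Real.log (1 - (n : ℝ) ^ (-(1 + δ)))
  refine h2.trans (tsum_congr fun n => ?_)
  simp [Set.indicator]

/-- **Mertens' third theorem**, in logarithmic form. -/
theorem tendsto_sum_primes_neg_log_sub_log_log :
    Tendsto (fun N : ℕ => ∑ n ∈ Finset.range N, (if n.Prime then -Real.log (1 - (n : ℝ)⁻¹) else 0) -
      Real.log (Real.log N)) atTop (𝓝 Real.eulerMascheroniConstant) := by
  obtain ⟨M, hM⟩ := exists_tendsto_sum_primes_inv_sub_log_log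
  let h : ℕ → ℝ := fun n => if n.Prime then -Real.log (1 - (n : ℝ)⁻¹) - (n : ℝ)⁻¹ else 0
  have hsum : Summable h := by
    refine Summable.of_norm_bounded summable_two_mul_inv_sq fun n => ?_
    simp only [h]
    split_ifs with hn
    · exact abs_neg_log_one_sub_sub_le (by positivity) hn.cast_inv_le_half
    · simp only [norm_zero]
      positivity
  have h1 := tendsto_sum_primes_rpow_add_log hM
  have h2 := tendsto_sum_primes_log_sub
  have h3 : Tendsto (fun δ : ℝ => Real.log (riemannZeta ((1 + δ : ℝ) : ℂ)).re + Real.log δ)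
      (𝓝[>] 0) (𝓝 0) := by
    have := (isLittleO_one_iff ℝ).1 log_riemannZeta_add_log_sub_isLittleO_ofReal
    have hm : Tendsto (fun δ : ℝ => 1 + δ) (𝓝[>] 0) (𝓝[>] 1) := by
      refine tendsto_nhdsWithin_iff.2 ⟨tendsto_nhdsWithin_of_tendsto_nhds ?_, ?_⟩
      · have : Continuous fun δ : ℝ => 1 + δ := by fun_prop
        simpa using this.tendsto 0
      · filter_upwards [self_mem_nhdsWithin] with δ hδ
        simpa using hδ
    refine (this.comp hm).congr fun δ => ?_
    simp
  have h4 : Tendsto (fun δ : ℝ => Real.log ((1 - Real.exp (-δ)) / δ)) (𝓝[>] 0) (𝓝 0) := by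
    have hd : HasDerivAt (fun δ : ℝ => 1 - Real.exp (-δ)) 1 0 := by
      have := ((hasDerivAt_neg (0 : ℝ)).exp).const_sub 1
      simpa using this
    have := hd.tendsto_slope_zero_right
    simp only [zero_add, neg_zero, Real.exp_zero, sub_self, sub_zero, smul_eq_mul] at this
    have := this.log one_ne_zero
    rw [Real.log_one] at this
    refine this.congr fun δ => ?_
    rw [div_eq_inv_mul]
  -- `log ζ(1 + δ) + log(1 - e^{-δ})` tends to the left side by `h1` and `h2`, and to `0` by `h3`
  -- and `h4`.
  have h5 : M - Real.eulerMascheroniConstant + ∑' n, h n = 0 := by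
    have := ((h1.add h2).sub (h3.add h4))
    rw [add_zero, sub_zero] at this
    refine tendsto_nhds_unique this (tendsto_const_nhds.congr' ?_)
    filter_upwards [self_mem_nhdsWithin] with δ hδ
    have hδ' : (0 : ℝ) < δ := hδ
    have he : Real.exp (-δ) < 1 := by
      rw [Real.exp_lt_one_iff]
      linarith
    rw [log_riemannZeta_eq_tsum_primes hδ, Real.log_div (by linarith) hδ'.ne']
    have hs1 : Summable fun n : ℕ => if n.Prime then (n : ℝ) ^ (-(1 + δ)) else 0 := by
      refine Summable.of_nonneg_of_le (fun n => ?_) (fun n => ?_)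
        (Real.summable_nat_rpow.2 (show -(1 + δ) < -1 by linarith))
      · split_ifs <;> positivity
      · split_ifs
        · rfl
        · positivity
    have hs2 : Summable fun n : ℕ => if n.Prime then
        -Real.log (1 - (n : ℝ) ^ (-(1 + δ))) - (n : ℝ) ^ (-(1 + δ)) else 0 := by
      refine Summable.of_norm_bounded summable_two_mul_inv_sq fun n => ?_
      split_ifs with hn
      · have h1 := rpow_neg_one_add_le_inv hn hδ'
        have h0 : 0 ≤ (n : ℝ) ^ (-(1 + δ)) := by positivity
        refine (abs_neg_log_one_sub_sub_le h0 (h1.trans hn.cast_inv_le_half)).trans ?_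
        gcongr
      · simp only [norm_zero]
        positivity
    have : ∑' n : ℕ, (if n.Prime then -Real.log (1 - (n : ℝ) ^ (-(1 + δ))) else 0) =
        ∑' n : ℕ, (if n.Prime then (n : ℝ) ^ (-(1 + δ)) else 0) + ∑' n : ℕ, if n.Prime then
        -Real.log (1 - (n : ℝ) ^ (-(1 + δ))) - (n : ℝ) ^ (-(1 + δ)) else 0 := by
      rw [← hs1.tsum_add hs2]
      refine tsum_congr fun n => ?_
      split_ifs <;> ring
    rw [this]
    ring
  have h6 := hM.add hsum.hasSum.tendsto_sum_nat
  rw [show M + ∑' n, h n = Real.eulerMascheroniConstant by linarith] at h6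
  refine h6.congr fun N => ?_
  rw [sub_add_eq_add_sub, ← Finset.sum_add_distrib]
  congr 1
  refine Finset.sum_congr rfl fun n _ => ?_
  simp only [h]
  split_ifs <;> ring

/-! ### Möbius inversion for the logarithm -/

theorem hasSum_pnat_pow_div {z : ℂ} (hz : ‖z‖ < 1) :
    HasSum (fun j : ℕ+ => z ^ (j : ℕ) / ((j : ℕ) : ℂ)) (-Complex.log (1 - z)) := by
  have h := Complex.hasSum_taylorSeries_neg_log hz
  refine (PNat.coe_injective.hasSum_iff (f := fun n : ℕ => z ^ n / (n : ℂ)) fun n hn => ?_).2 h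
  rcases Nat.eq_zero_or_pos n with rfl | h0
  · simp
  · exact absurd ⟨⟨n, h0⟩, rfl⟩ hn

theorem norm_moebius_div_mul_le (k : ℕ+) (w : ℂ) :
    ‖((ArithmeticFunction.moebius (k : ℕ) : ℤ) : ℂ) / ((k : ℕ) : ℂ) * w‖ ≤ ‖w‖ := by
  rw [norm_mul, norm_div, Complex.norm_intCast, Complex.norm_natCast]
  refine mul_le_of_le_one_left (norm_nonneg _) (div_le_one_of_le₀ ?_ (Nat.cast_nonneg _))
  have h1 : |((ArithmeticFunction.moebius (k : ℕ) : ℤ) : ℝ)| ≤ 1 := by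
    exact_mod_cast ArithmeticFunction.abs_moebius_le_one
  exact h1.trans (by exact_mod_cast k.2)

/-- The term `μ(k) z^{kj} / (kj)`. -/
noncomputable def moebiusPowTerm (z : ℂ) (x : ℕ+ × ℕ+) : ℂ :=
  ((ArithmeticFunction.moebius (x.1 : ℕ) : ℤ) : ℂ) / ((x.1 : ℕ) : ℂ) *
    ((z ^ (x.1 : ℕ)) ^ (x.2 : ℕ) / ((x.2 : ℕ) : ℂ))

theorem summable_moebiusPowTerm {z : ℂ} (hz : ‖z‖ < 1) : Summable (moebiusPowTerm z) := by
  have h0 := summable_prod_mul_pow 0 (r := ‖z‖) (by simpa using hz)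
  refine Summable.of_norm_bounded h0 fun x => (norm_moebius_div_mul_le _ _).trans ?_
  rw [norm_div, norm_pow, norm_pow, Complex.norm_natCast, pow_zero, one_mul, ← pow_mul]
  exact div_le_self (by positivity) (by exact_mod_cast x.2.2)

/-- Grouping by `n = kj`, the power `z^n / n` factors out and `∑_{k ∣ n} μ(k)` remains. -/
theorem sum_divisorsAntidiagonal_moebiusPowTerm (z : ℂ) (n : ℕ+) :
    ∑ x : (n : ℕ).divisorsAntidiagonal, moebiusPowTerm z (sigmaAntidiagonalEquivProd ⟨n, x⟩) =
      if n = 1 then z else 0 := by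
  have h1 : ∀ x : (n : ℕ).divisorsAntidiagonal,
      moebiusPowTerm z (sigmaAntidiagonalEquivProd ⟨n, x⟩) =
        ((ArithmeticFunction.moebius x.1.1 : ℤ) : ℂ) * (z ^ (n : ℕ) / ((n : ℕ) : ℂ)) := by
    rintro ⟨x, hx⟩
    have hx' := (Nat.mem_divisorsAntidiagonal.1 hx).1
    have hgx : moebiusPowTerm z (sigmaAntidiagonalEquivProd ⟨n, ⟨x, hx⟩⟩) =
      ((ArithmeticFunction.moebius x.1 : ℤ) : ℂ) / (x.1 : ℂ) *
        ((z ^ x.1) ^ x.2 / (x.2 : ℂ)) := rfl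
    have hn : ((n : ℕ) : ℂ) = x.1 * x.2 := by rw [← hx', Nat.cast_mul]
    rw [hgx, hn, div_mul_div_comm, ← pow_mul, hx', mul_div_assoc]
  rw [Finset.sum_congr rfl fun x _ => h1 x, ← Finset.sum_mul,
    Finset.sum_coe_sort (n : ℕ).divisorsAntidiagonal
      (fun x => ((ArithmeticFunction.moebius x.1 : ℤ) : ℂ)),
    Nat.sum_divisorsAntidiagonal (fun i _ => ((ArithmeticFunction.moebius i : ℤ) : ℂ)),
    ← Int.cast_sum, ← ArithmeticFunction.coe_mul_zeta_apply,
    ArithmeticFunction.moebius_mul_coe_zeta, ArithmeticFunction.one_apply]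
  by_cases hn : n = 1
  · simp [hn]
  · simp [hn]

theorem hasSum_moebiusPowTerm {z : ℂ} (hz : ‖z‖ < 1) : HasSum (moebiusPowTerm z) z := by
  rw [← sigmaAntidiagonalEquivProd.hasSum_iff]
  have hs := (sigmaAntidiagonalEquivProd.summable_iff.2 (summable_moebiusPowTerm hz)).hasSum
  have h1 := hs.sigma fun n => hasSum_fintype _
  simp only [Function.comp_apply, sum_divisorsAntidiagonal_moebiusPowTerm] at h1
  have h2 := h1.unique (hasSum_ite_eq 1 z)
  have h3 := hs
  rwa [show ∑' b, (moebiusPowTerm z ∘ sigmaAntidiagonalEquivProd) b = z from h2] at h3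

theorem hasSum_moebius_div_mul_neg_log {z : ℂ} (hz : ‖z‖ < 1) :
    HasSum (fun k : ℕ+ => ((ArithmeticFunction.moebius (k : ℕ) : ℤ) : ℂ) / ((k : ℕ) : ℂ) *
      -Complex.log (1 - z ^ (k : ℕ))) z := by
  have key : ∀ k : ℕ+, HasSum (fun j : ℕ+ => moebiusPowTerm z (k, j))
      (((ArithmeticFunction.moebius (k : ℕ) : ℤ) : ℂ) / ((k : ℕ) : ℂ) *
        -Complex.log (1 - z ^ (k : ℕ))) := fun k => by
    have hk : ‖z ^ (k : ℕ)‖ < 1 := by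
      rw [norm_pow]
      exact pow_lt_one₀ (norm_nonneg _) hz (PNat.ne_zero k)
    simp only [moebiusPowTerm]
    exact (hasSum_pnat_pow_div hk).mul_left
      (((ArithmeticFunction.moebius (k : ℕ) : ℤ) : ℂ) / ((k : ℕ) : ℂ))
  exact (hasSum_moebiusPowTerm hz).prod_fiberwise key

/-! ### Convergence of the truncated Euler products -/

/-- The primes `p ≤ N` with `B < p`. -/
noncomputable def primesBetween (B : ℝ) (N : ℕ) : Finset ℕ :=
  (Finset.Iic N).filter fun p : ℕ => p.Prime ∧ B < (p : ℝ)

theorem prime_of_mem_primesBetween {B : ℝ} {N p : ℕ} (hp : p ∈ primesBetween B N) : p.Prime :=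
  (Finset.mem_filter.1 hp).2.1

theorem sum_range_ite_prime_eq {M : Type*} [AddCommMonoid M] (f : ℕ → M) {B : ℝ} (hB : 0 ≤ B)
    {N : ℕ} (hN : ⌊B⌋₊ ≤ N) : ∑ n ∈ Finset.range (N + 1), (if n.Prime then f n else 0) =
      ∑ p ∈ primesUpTo B, f p + ∑ p ∈ primesBetween B N, f p := by
  rw [← Finset.sum_filter, ← Finset.sum_filter_add_sum_filter_not _ (fun n : ℕ => (n : ℝ) ≤ B),
    Finset.filter_filter, Finset.filter_filter]
  congr 2
  · ext p
    simp only [primesUpTo, Finset.mem_filter, Finset.mem_range, Finset.mem_Iic, Nat.le_floor_iff hB]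
    refine ⟨fun h => ⟨h.2.2, h.2.1⟩, fun h => ⟨?_, h.2, h.1⟩⟩
    exact Nat.lt_succ_of_le (((Nat.le_floor_iff hB).2 h.1).trans hN)
  · ext p
    simp [primesBetween]

theorem tendsto_sum_primesBetween {f : ℕ → ℂ} {l : ℂ}
    (h : Tendsto (fun N => ∑ n ∈ Finset.range N, if n.Prime then f n else 0) atTop (𝓝 l)) {B : ℝ}
    (hB : 0 ≤ B) : ∃ l', Tendsto (fun N => ∑ p ∈ primesBetween B N, f p) atTop (𝓝 l') := by
  refine ⟨_, ((h.comp (tendsto_add_atTop_nat 1)).sub_const (∑ p ∈ primesUpTo B, f p)).congr' ?_⟩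
  filter_upwards [eventually_ge_atTop ⌊B⌋₊] with N hN
  rw [Function.comp_apply, sum_range_ite_prime_eq f hB hN, add_sub_cancel_left]

section

variable {q : ℕ} (χ : DirichletCharacter ℂ q)

theorem norm_div_natCast_pow_le (n s : ℕ) : ‖χ (n : ZMod q) / (n : ℂ) ^ s‖ ≤ ((n : ℝ)⁻¹) ^ s := by
  rw [norm_div, norm_pow, Complex.norm_natCast, inv_pow, div_eq_mul_inv]
  exact mul_le_of_le_one_left (by positivity) (χ.norm_le_one _)

theorem norm_div_prime_pow_le_half {p s : ℕ} (hp : p.Prime) (hs : s ≠ 0) :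
    ‖χ (p : ZMod q) / (p : ℂ) ^ s‖ ≤ 1 / 2 :=
  (norm_div_natCast_pow_le χ p s).trans
    ((pow_le_of_le_one (by positivity) (hp.cast_inv_le_half.trans (by norm_num)) hs).trans
      hp.cast_inv_le_half)

theorem one_sub_div_prime_pow_ne_zero {p s : ℕ} (hp : p.Prime) (hs : s ≠ 0) :
    1 - χ (p : ZMod q) / (p : ℂ) ^ s ≠ 0 := by
  intro h
  have := norm_div_prime_pow_le_half χ hp hs
  rw [← sub_eq_zero.1 h, norm_one] at this
  norm_num at this

theorem logEulerTailPartial_natCast (B : ℝ) (s N : ℕ) : logEulerTailPartial χ B (s : ℂ) N =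
    ∑ p ∈ primesBetween B N, -Complex.log (1 - χ (p : ZMod q) / (p : ℂ) ^ s) := by
  simp only [logEulerTailPartial, primesBetween, Complex.cpow_natCast, Finset.sum_neg_distrib]

theorem exp_logEulerTailPartial (B : ℝ) {s : ℕ} (hs : s ≠ 0) (N : ℕ) :
    Complex.exp (logEulerTailPartial χ B (s : ℂ) N) = eulerTailPartial χ B (s : ℂ) N := by
  rw [logEulerTailPartial_natCast, Complex.exp_sum, eulerTailPartial]
  refine Finset.prod_congr rfl fun p hp => ?_
  rw [Complex.exp_neg, Complex.exp_log
    (one_sub_div_prime_pow_ne_zero χ (prime_of_mem_primesBetween hp) hs), Complex.cpow_natCast]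

theorem norm_neg_log_one_sub_sub_le {w : ℂ} (hw : ‖w‖ ≤ 1 / 2) :
    ‖-Complex.log (1 - w) - w‖ ≤ 2 * ‖w‖ ^ 2 := by
  have h := Complex.norm_log_one_add_sub_self_le (z := -w) (by rw [norm_neg]; linarith)
  rw [norm_neg, ← sub_eq_add_neg, sub_neg_eq_add] at h
  rw [← norm_neg, neg_sub, sub_neg_eq_add, add_comm]
  refine h.trans ?_
  have : (1 - ‖w‖)⁻¹ ≤ 2 := by
    rw [inv_le_comm₀ (by linarith) two_pos]
    linarith
  nlinarith [mul_le_mul_of_nonneg_left this (sq_nonneg ‖w‖), sq_nonneg ‖w‖]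

/-- Cancellation is needed only at `s = 1`. For `χ^k` at `s = km` that case forces `k = 1`, so a
principal `χ^k` never meets it. -/
theorem exists_tendsto_sum_primes_div_pow [NeZero q] {s : ℕ} (hs : s ≠ 0) (h : s = 1 → χ ≠ 1) :
    ∃ l, Tendsto (fun N : ℕ => ∑ n ∈ Finset.range N,
      if n.Prime then χ (n : ZMod q) / (n : ℂ) ^ s else 0) atTop (𝓝 l) := by
  rcases eq_or_ne s 1 with rfl | h1
  · simpa using DirichletCharacter.exists_tendsto_sum_primes_div (h rfl)
  · have hsum := (Real.summable_nat_pow_inv (p := s)).2 (by omega)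
    have : Summable fun n : ℕ => if n.Prime then χ (n : ZMod q) / (n : ℂ) ^ s else 0 := by
      refine Summable.of_norm_bounded hsum fun n => ?_
      split_ifs
      · simpa using norm_div_natCast_pow_le χ n s
      · simp
    exact ⟨_, this.hasSum.tendsto_sum_nat⟩

theorem tendsto_logEulerTailPartial [NeZero q] {B : ℝ} (hB : 0 ≤ B) {s : ℕ} (hs : s ≠ 0)
    (h : s = 1 → χ ≠ 1) :
    Tendsto (logEulerTailPartial χ B (s : ℂ)) atTop (𝓝 (logEulerTail χ B (s : ℂ))) := by
  have : ∃ l, Tendsto (logEulerTailPartial χ B (s : ℂ)) atTop (𝓝 l) := by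
    obtain ⟨l₁, h₁⟩ := exists_tendsto_sum_primes_div_pow χ hs h
    -- `-log(1 - w) - w` is at most `2|w|^2`, so the logarithms differ from `χ(p) p^{-s}` by an
    -- absolutely convergent series.
    have hsum : Summable fun n : ℕ => if n.Prime then
        -Complex.log (1 - χ (n : ZMod q) / (n : ℂ) ^ s) - χ (n : ZMod q) / (n : ℂ) ^ s else 0 := by
      refine Summable.of_norm_bounded summable_two_mul_inv_sq fun n => ?_
      split_ifs with hn
      · refine (norm_neg_log_one_sub_sub_le (norm_div_prime_pow_le_half χ hn hs)).trans ?_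
        gcongr
        exact (norm_div_natCast_pow_le χ n s).trans
          (pow_le_of_le_one (by positivity) (hn.cast_inv_le_half.trans (by norm_num)) hs)
      · simp only [norm_zero]
        positivity
    have h₂ : Tendsto (fun N => ∑ n ∈ Finset.range N, if n.Prime then
        -Complex.log (1 - χ (n : ZMod q) / (n : ℂ) ^ s) else 0) atTop (𝓝 (l₁ + ∑' n : ℕ, if n.Prime then
        -Complex.log (1 - χ (n : ZMod q) / (n : ℂ) ^ s) - χ (n : ZMod q) / (n : ℂ) ^ s else 0)) := by
      refine (h₁.add hsum.hasSum.tendsto_sum_nat).congr fun N => ?_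
      rw [← Finset.sum_add_distrib]
      refine Finset.sum_congr rfl fun n _ => ?_
      split_ifs <;> ring
    obtain ⟨l, hl⟩ := tendsto_sum_primesBetween h₂ hB
    exact ⟨l, hl.congr fun N => (logEulerTailPartial_natCast χ B s N).symm⟩
  exact tendsto_nhds_limUnder this

theorem tendsto_eulerTailPartial [NeZero q] {B : ℝ} (hB : 0 ≤ B) {s : ℕ} (hs : s ≠ 0)
    (h : s = 1 → χ ≠ 1) :
    Tendsto (eulerTailPartial χ B (s : ℂ)) atTop (𝓝 (eulerTail χ B (s : ℂ))) ∧
      Complex.exp (logEulerTail χ B (s : ℂ)) = eulerTail χ B (s : ℂ) := by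
  have h1 := (tendsto_logEulerTailPartial χ hB hs h).cexp
  simp only [exp_logEulerTailPartial χ B hs] at h1
  have h2 : Complex.exp (logEulerTail χ B (s : ℂ)) = eulerTail χ B (s : ℂ) := h1.limUnder_eq.symm
  exact ⟨h2 ▸ h1, h2⟩

/-! ### The double series -/

theorem exists_norm_logEulerTailPartial_le_of_two_le (B : ℝ) :
    ∃ C, 0 ≤ C ∧ ∀ (η : DirichletCharacter ℂ q) (s N : ℕ), 2 ≤ s →
      ‖logEulerTailPartial η B (s : ℂ) N‖ ≤ C * (1 / 2) ^ s := by
  -- From `p^{-s} ≤ p^{-2} 2^{-(s-2)}`: the `4` restores `2^{-s}`, and the `2` exceeds the constant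
  -- `3/2` in the bound for the logarithm.
  refine ⟨∑' n : ℕ, 4 * (2 * ((n : ℝ)⁻¹) ^ 2), tsum_nonneg fun n => by positivity,
    fun η s N hs => ?_⟩
  obtain ⟨t, rfl⟩ := Nat.exists_eq_add_of_le hs
  rw [logEulerTailPartial_natCast, ← tsum_mul_right]
  refine (norm_sum_le_of_le _ fun p hp => ?_).trans
    ((summable_two_mul_inv_sq.mul_left 4).mul_right _ |>.sum_le_tsum (primesBetween B N)
      fun n _ => by positivity)
  have hp' := prime_of_mem_primesBetween hp
  have hw := norm_div_prime_pow_le_half η hp' (s := 2 + t) (by omega)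
  have := Complex.norm_log_one_add_half_le_self (z := -(η (p : ZMod q) / (p : ℂ) ^ (2 + t)))
    (by rwa [norm_neg])
  rw [norm_neg, ← sub_eq_add_neg] at this
  rw [norm_neg]
  refine this.trans ?_
  have h1 := norm_div_natCast_pow_le η p (2 + t)
  have h2 : ((p : ℝ)⁻¹) ^ (2 + t) ≤ ((p : ℝ)⁻¹) ^ 2 * (1 / 2) ^ t := by
    rw [pow_add]
    gcongr
    exact hp'.cast_inv_le_half
  have h3 : (0 : ℝ) ≤ ((p : ℝ)⁻¹) ^ 2 * (1 / 2) ^ t := by positivity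
  rw [pow_add (1 / 2 : ℝ) 2 t]
  linarith

variable {χ}

theorem exists_norm_logEulerTailPartial_le [NeZero q] (hχ : χ ≠ 1) {B : ℝ} (hB : 0 ≤ B) :
    ∃ C, 0 ≤ C ∧ ∀ (m k : ℕ+) (N : ℕ),
      ‖logEulerTailPartial (χ ^ (k : ℕ)) B (((k : ℕ) * (m : ℕ) : ℕ) : ℂ) N‖ ≤
        C * (1 / 2) ^ ((k : ℕ) * (m : ℕ)) := by
  obtain ⟨C, hC, h2⟩ := exists_norm_logEulerTailPartial_le_of_two_le (q := q) B
  obtain ⟨D, hD⟩ := (tendsto_logEulerTailPartial χ hB one_ne_zero fun _ => hχ).norm.bddAbove_range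
  have hD0 : 0 ≤ D := (norm_nonneg _).trans (hD ⟨0, rfl⟩)
  -- `D` bounds the convergent partial sums at `km = 1`; the `2` offsets the factor `(1/2)^1`.
  refine ⟨C + 2 * D, by positivity, fun m k N => ?_⟩
  rcases eq_or_ne ((k : ℕ) * (m : ℕ)) 1 with h1 | h1
  · have hk : (k : ℕ) = 1 := Nat.eq_one_of_mul_eq_one_right h1
    rw [h1, hk, pow_one, pow_one]
    have := hD ⟨N, rfl⟩
    rw [Nat.cast_one] at this ⊢
    linarith
  · have hpos := Nat.mul_pos k.pos m.pos
    refine (h2 _ _ N (by omega)).trans ?_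
    gcongr
    linarith

theorem tendsto_logEulerTailPartial_pow [NeZero q] (hχ : χ ≠ 1) {B : ℝ} (hB : 0 ≤ B) (m k : ℕ+) :
    Tendsto (logEulerTailPartial (χ ^ (k : ℕ)) B (((k : ℕ) * (m : ℕ) : ℕ) : ℂ)) atTop
      (𝓝 (logEulerTail (χ ^ (k : ℕ)) B (((k : ℕ) * (m : ℕ) : ℕ) : ℂ))) := by
  refine tendsto_logEulerTailPartial _ hB (Nat.mul_pos k.pos m.pos).ne' fun h => ?_
  rwa [Nat.eq_one_of_mul_eq_one_right h, pow_one]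

/-- With finitely many primes, Möbius inversion is applied at each prime and the results are added.
-/
theorem hasSum_moebius_logEulerTailPartial (χ : DirichletCharacter ℂ q) (B : ℝ) (m : ℕ+) (N : ℕ) :
    HasSum (fun k : ℕ+ => ((ArithmeticFunction.moebius (k : ℕ) : ℤ) : ℂ) / ((k : ℕ) : ℂ) *
      logEulerTailPartial (χ ^ (k : ℕ)) B (((k : ℕ) * (m : ℕ) : ℕ) : ℂ) N)
      (∑ p ∈ primesBetween B N, χ (p : ZMod q) / (p : ℂ) ^ (m : ℕ)) := by
  have key := hasSum_sum (s := primesBetween B N) fun p hp =>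
    hasSum_moebius_div_mul_neg_log (z := χ (p : ZMod q) / (p : ℂ) ^ (m : ℕ))
      ((norm_div_prime_pow_le_half χ (prime_of_mem_primesBetween hp) m.ne_zero).trans_lt
        (by norm_num))
  refine key.congr_fun fun k => ?_
  rw [logEulerTailPartial_natCast, Finset.mul_sum]
  refine Finset.sum_congr rfl fun p _ => ?_
  rw [MulChar.pow_apply' _ k.ne_zero, div_pow, ← pow_mul, mul_comm (m : ℕ)]

theorem summable_pnat_half_pow : Summable fun k : ℕ+ => (1 / 2 : ℝ) ^ (k : ℕ) :=
  summable_geometric_two.comp_injective PNat.coe_injective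

theorem half_pow_mul_le (m k : ℕ+) :
    (1 / 2 : ℝ) ^ ((k : ℕ) * (m : ℕ)) ≤ 2 * (1 / 2) ^ (k : ℕ) * (1 / 2) ^ (m : ℕ) := by
  -- This is `(k - 1)(m - 1) ≥ 0`; it separates the variables in the dominating bound.
  have h : (k : ℕ) + (m : ℕ) ≤ (k : ℕ) * (m : ℕ) + 1 := by
    have := k.pos
    have := m.pos
    nlinarith
  calc (1 / 2 : ℝ) ^ ((k : ℕ) * (m : ℕ)) = 2 * (1 / 2) ^ ((k : ℕ) * (m : ℕ) + 1) := by
        rw [pow_succ]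
        ring
    _ ≤ 2 * (1 / 2) ^ ((k : ℕ) + (m : ℕ)) := by
        refine mul_le_mul_of_nonneg_left ?_ two_pos.le
        exact pow_le_pow_of_le_one (by norm_num) (by norm_num) h
    _ = _ := by rw [pow_add]; ring

/-- Dominated convergence in `k`. The last bound, uniform in `N`, is the domination for the later
passage to the limit under the sum over `m`. -/
theorem exists_moebiusTerm_bounds [NeZero q] (hχ : χ ≠ 1) {B : ℝ} (hB : 0 ≤ B) :
    (∀ m : ℕ+, Summable fun k : ℕ+ => moebiusTerm χ B m k) ∧
    (∀ m : ℕ+, Tendsto (fun N => ∑ p ∈ primesBetween B N, χ (p : ZMod q) / (p : ℂ) ^ (m : ℕ)) atTop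
      (𝓝 (∑' k : ℕ+, moebiusTerm χ B m k))) ∧
    ∃ C : ℝ, ∀ (m : ℕ+) (N : ℕ),
      ‖∑ p ∈ primesBetween B N, χ (p : ZMod q) / (p : ℂ) ^ (m : ℕ)‖ ≤ C * (1 / 2) ^ (m : ℕ) := by
  obtain ⟨C, hC, hle⟩ := exists_norm_logEulerTailPartial_le hχ hB
  have hle' : ∀ m k : ℕ+, ∀ N : ℕ, ‖((ArithmeticFunction.moebius (k : ℕ) : ℤ) : ℂ) / ((k : ℕ) : ℂ) *
      logEulerTailPartial (χ ^ (k : ℕ)) B (((k : ℕ) * (m : ℕ) : ℕ) : ℂ) N‖ ≤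
        C * (2 * (1 / 2) ^ (k : ℕ) * (1 / 2) ^ (m : ℕ)) := fun m k N =>
    (norm_moebius_div_mul_le k _).trans ((hle m k N).trans
      (mul_le_mul_of_nonneg_left (half_pow_mul_le m k) hC))
  have hlim : ∀ m k : ℕ+, Tendsto (fun N => ((ArithmeticFunction.moebius (k : ℕ) : ℤ) : ℂ) /
      ((k : ℕ) : ℂ) * logEulerTailPartial (χ ^ (k : ℕ)) B (((k : ℕ) * (m : ℕ) : ℕ) : ℂ) N) atTop
        (𝓝 (moebiusTerm χ B m k)) := fun m k =>
    (tendsto_logEulerTailPartial_pow hχ hB m k).const_mul _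
  have hsum : ∀ m : ℕ+, Summable fun k : ℕ+ =>
      C * (2 * (1 / 2 : ℝ) ^ (k : ℕ) * (1 / 2) ^ (m : ℕ)) := fun m =>
    ((summable_pnat_half_pow.mul_left 2).mul_right _).mul_left _
  refine ⟨fun m => ?_, fun m => ?_, C * (2 * ∑' k : ℕ+, (1 / 2 : ℝ) ^ (k : ℕ)), fun m N => ?_⟩
  · exact Summable.of_norm_bounded (hsum m) fun k =>
      le_of_tendsto (hlim m k).norm (Eventually.of_forall fun N => hle' m k N)
  · refine (tendsto_tsum_of_dominated_convergence (hsum m) (hlim m)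
      (Eventually.of_forall fun N k => hle' m k N)).congr fun N => ?_
    exact (hasSum_moebius_logEulerTailPartial χ B m N).tsum_eq
  · rw [← (hasSum_moebius_logEulerTailPartial χ B m N).tsum_eq]
    refine (tsum_of_norm_bounded (hsum m).hasSum fun k => hle' m k N).trans (le_of_eq ?_)
    rw [tsum_mul_left, tsum_mul_right, tsum_mul_left]
    ring

theorem norm_one_div_pnat_mul_le (m : ℕ+) (w : ℂ) : ‖1 / ((m : ℕ) : ℂ) * w‖ ≤ ‖w‖ := by
  rw [norm_mul, norm_div, norm_one, Complex.norm_natCast]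
  exact mul_le_of_le_one_left (norm_nonneg _)
    (div_le_one_of_le₀ (by exact_mod_cast m.2) (Nat.cast_nonneg _))

theorem summable_one_div_mul_tsum_moebiusTerm [NeZero q] (hχ : χ ≠ 1) {B : ℝ} (hB : 0 ≤ B) :
    Summable fun m : ℕ+ => 1 / ((m : ℕ) : ℂ) * ∑' k : ℕ+, moebiusTerm χ B m k := by
  obtain ⟨-, hlim, C, hC⟩ := exists_moebiusTerm_bounds hχ hB
  refine Summable.of_norm_bounded (summable_pnat_half_pow.mul_left C) fun m => ?_
  exact (norm_one_div_pnat_mul_le m _).trans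
    (le_of_tendsto (hlim m).norm (Eventually.of_forall fun N => hC m N))

theorem hasSum_one_div_mul_sum_primesBetween (χ : DirichletCharacter ℂ q) (B : ℝ) (N : ℕ) :
    HasSum (fun m : ℕ+ => 1 / ((m : ℕ) : ℂ) *
      ∑ p ∈ primesBetween B N, χ (p : ZMod q) / (p : ℂ) ^ (m : ℕ))
      (∑ p ∈ primesBetween B N, χ (p : ZMod q) * ((-Real.log (1 - (p : ℝ)⁻¹) : ℝ) : ℂ)) := by
  have key := hasSum_sum (s := primesBetween B N) (L := SummationFilter.unconditional ℕ+)
    (f := fun (p : ℕ) m => χ (p : ZMod q) * (((p : ℂ)⁻¹) ^ ((m : ℕ+) : ℕ) / ((m : ℕ) : ℂ)))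
    (a := fun (p : ℕ) => χ (p : ZMod q) * ((-Real.log (1 - (p : ℝ)⁻¹) : ℝ) : ℂ)) fun p hp => ?_
  · refine key.congr_fun fun m => ?_
    rw [Finset.mul_sum]
    refine Finset.sum_congr rfl fun p _ => ?_
    rw [inv_pow]
    ring
  · have hp2 := (prime_of_mem_primesBetween hp).cast_inv_le_half
    have hp1 : ‖(p : ℂ)⁻¹‖ < 1 := by
      rw [norm_inv, Complex.norm_natCast]
      linarith
    rw [Complex.ofReal_neg, Complex.ofReal_log (by linarith)]
    push_cast
    exact (hasSum_pnat_pow_div hp1).mul_left _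

theorem tendsto_sum_primesBetween_mul_neg_log [NeZero q] (hχ : χ ≠ 1) {B : ℝ} (hB : 0 ≤ B) :
    Tendsto (fun N => ∑ p ∈ primesBetween B N,
      χ (p : ZMod q) * ((-Real.log (1 - (p : ℝ)⁻¹) : ℝ) : ℂ)) atTop
      (𝓝 (∑' m : ℕ+, 1 / ((m : ℕ) : ℂ) * ∑' k : ℕ+, moebiusTerm χ B m k)) := by
  obtain ⟨-, hlim, C, hC⟩ := exists_moebiusTerm_bounds hχ hB
  refine (tendsto_tsum_of_dominated_convergence (summable_pnat_half_pow.mul_left C)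
    (fun m => (hlim m).const_mul _) (Eventually.of_forall fun N m =>
      (norm_one_div_pnat_mul_le m _).trans (hC m N))).congr fun N => ?_
  exact (hasSum_one_div_mul_sum_primesBetween χ B N).tsum_eq

end

/-! ### Orthogonality of characters -/

open scoped Classical in
theorem sum_conj_mul_eq_mertensExp {q : ℕ} [NeZero q] {a : ℤ} (ha : IsCoprime a (q : ℤ)) {p : ℕ}
    (hp : p.Prime) (hpq : ¬p ∣ q) :
    ∑ χ : DirichletCharacter ℂ q with χ ≠ 1, (starRingEnd ℂ) (χ (a : ZMod q)) * χ (p : ZMod q) =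
      ((mertensExp q a p : ℤ) : ℂ) := by
  have hau : IsUnit (a : ZMod q) := by
    rwa [ZMod.coe_int_isUnit_iff_isCoprime, isCoprime_comm]
  have hconj : ∀ χ : DirichletCharacter ℂ q,
      (starRingEnd ℂ) (χ (a : ZMod q)) = χ ((a : ZMod q)⁻¹) := fun χ => by
    rw [starRingEnd_apply, MulChar.star_apply', MulChar.inv_apply_eq_inv']
    refine inv_eq_of_mul_eq_one_left ?_
    rw [← map_mul, ZMod.inv_mul_of_unit _ hau, map_one]
  have h1 := DirichletCharacter.sum_char_inv_mul_char_eq ℂ hau (p : ZMod q)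
  -- The principal character contributes `1`, because `p ∤ q`; removing it accounts for the `-1` in
  -- `α`.
  rw [← Finset.add_sum_erase _ _ (Finset.mem_univ (1 : DirichletCharacter ℂ q)), ← hconj,
    MulChar.one_apply hau, MulChar.one_apply (ZMod.isUnit_prime_of_not_dvd hp hpq), map_one,
    one_mul] at h1
  have h2 : (Finset.univ.filter fun χ : DirichletCharacter ℂ q => χ ≠ 1) =
      Finset.univ.erase 1 := by
    ext χ
    simp
  have hiff : (a : ZMod q) = (p : ZMod q) ↔ (p : ℤ) ≡ a [ZMOD (q : ℤ)] := by
    rw [← ZMod.intCast_eq_intCast_iff, Int.cast_natCast, eq_comm]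
  simp only [hconj]
  rw [h2, eq_sub_of_add_eq' h1, mertensExp]
  simp only [hiff]
  split_ifs <;> simp

open scoped Classical in
/-- The character sum in the formula for `C(q, a)` is `-∑_{p > B} α(p) log (1 - 1/p)`. -/
theorem tendsto_sum_mertensExp_mul_neg_log {q : ℕ} [NeZero q] {a : ℤ} (ha : IsCoprime a (q : ℤ))
    {B : ℝ} (hB : 0 ≤ B) (hBq : ∀ p : ℕ, p.Prime → p ∣ q → (p : ℝ) ≤ B) :
    ∃ t : ℝ, ∑ χ : DirichletCharacter ℂ q with χ ≠ 1, (starRingEnd ℂ) (χ (a : ZMod q)) *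
        ∑' m : ℕ+, 1 / ((m : ℕ) : ℂ) * ∑' k : ℕ+, moebiusTerm χ B m k = (t : ℂ) ∧
      Tendsto (fun N => ∑ p ∈ primesBetween B N,
        (mertensExp q a p : ℝ) * -Real.log (1 - (p : ℝ)⁻¹)) atTop (𝓝 t) := by
  have h1 : Tendsto (fun N => ∑ χ : DirichletCharacter ℂ q with χ ≠ 1,
      (starRingEnd ℂ) (χ (a : ZMod q)) * ∑ p ∈ primesBetween B N,
        χ (p : ZMod q) * ((-Real.log (1 - (p : ℝ)⁻¹) : ℝ) : ℂ)) atTop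
      (𝓝 (∑ χ : DirichletCharacter ℂ q with χ ≠ 1, (starRingEnd ℂ) (χ (a : ZMod q)) *
        ∑' m : ℕ+, 1 / ((m : ℕ) : ℂ) * ∑' k : ℕ+, moebiusTerm χ B m k)) :=
    tendsto_finsetSum _ fun χ hχ =>
      (tendsto_sum_primesBetween_mul_neg_log (Finset.mem_filter.1 hχ).2 hB).const_mul _
  have h2 : ∀ N, ∑ χ : DirichletCharacter ℂ q with χ ≠ 1,
      (starRingEnd ℂ) (χ (a : ZMod q)) * ∑ p ∈ primesBetween B N,
        χ (p : ZMod q) * ((-Real.log (1 - (p : ℝ)⁻¹) : ℝ) : ℂ) =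
      ((∑ p ∈ primesBetween B N, (mertensExp q a p : ℝ) * -Real.log (1 - (p : ℝ)⁻¹) : ℝ) : ℂ) := by
    intro N
    simp only [Finset.mul_sum, ← mul_assoc]
    rw [Finset.sum_comm, Complex.ofReal_sum]
    refine Finset.sum_congr rfl fun p hp => ?_
    have hp' := (Finset.mem_filter.1 hp).2
    rw [← Finset.sum_mul, sum_conj_mul_eq_mertensExp ha hp'.1
      fun hd => absurd (hBq p hp'.1 hd) (not_le.2 hp'.2)]
    push_cast
    rfl
  simp only [h2] at h1
  -- The finite sums over primes are real, hence so is their limit.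
  have h3 := (Complex.continuous_re.tendsto _).comp h1
  have h4 := (Complex.continuous_ofReal.tendsto _).comp h3
  exact ⟨_, tendsto_nhds_unique h1 h4, h3⟩

/-! ### The Mertens constant -/

theorem one_sub_one_div_prime_pos {p : ℕ} (hp : p.Prime) : 0 < 1 - 1 / (p : ℝ) := by
  have := hp.cast_inv_le_half
  rw [one_div]
  linarith

theorem prime_of_mem_primesUpTo {x : ℝ} {p : ℕ} (hp : p ∈ primesUpTo x) : p.Prime :=
  (Finset.mem_filter.1 hp).2

theorem mertensProd_pos (q : ℕ) (a : ℤ) (x : ℝ) : 0 < mertensProd q a x :=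
  Finset.prod_pos fun _ hp => one_sub_one_div_prime_pos
    (prime_of_mem_primesUpTo (Finset.mem_filter.1 hp).1)

theorem log_prod_mertensExp (q : ℕ) (a : ℤ) (B : ℝ) :
    Real.log (∏ p ∈ primesUpTo B, (1 - 1 / (p : ℝ)) ^ mertensExp q a p) =
      -∑ p ∈ primesUpTo B, (mertensExp q a p : ℝ) * -Real.log (1 - (p : ℝ)⁻¹) := by
  have h : ∀ p ∈ primesUpTo B, (1 - 1 / (p : ℝ)) ^ mertensExp q a p ≠ 0 := fun p hp =>
    (zpow_pos (one_sub_one_div_prime_pos (prime_of_mem_primesUpTo hp)) _).ne'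
  rw [Real.log_prod h, ← Finset.sum_neg_distrib]
  refine Finset.sum_congr rfl fun p _ => ?_
  rw [Real.log_zpow, one_div]
  ring

/-- Termwise this is `φ(q) · 1_{p ≡ a} = α(p) + 1`. -/
theorem totient_mul_log_mertensProd (q : ℕ) (a : ℤ) (x : ℝ) :
    (q.totient : ℝ) * Real.log (mertensProd q a x) =
      -(∑ n ∈ Finset.range (⌊x⌋₊ + 1), if n.Prime then
          (mertensExp q a n : ℝ) * -Real.log (1 - (n : ℝ)⁻¹) else 0) -
        ∑ n ∈ Finset.range (⌊x⌋₊ + 1), if n.Prime then -Real.log (1 - (n : ℝ)⁻¹) else 0 := by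
  have h : ∀ p ∈ (primesUpTo x).filter (fun p : ℕ => (p : ℤ) ≡ a [ZMOD (q : ℤ)]),
      1 - 1 / (p : ℝ) ≠ 0 := fun p hp =>
    (one_sub_one_div_prime_pos (prime_of_mem_primesUpTo (Finset.mem_filter.1 hp).1)).ne'
  rw [mertensProd, Real.log_prod h, Finset.sum_filter, primesUpTo,
    Finset.sum_filter, Finset.mul_sum, ← Finset.sum_neg_distrib, ← Finset.sum_sub_distrib,
    Nat.range_succ_eq_Iic]
  refine Finset.sum_congr rfl fun p _ => ?_
  by_cases hp : p.Prime
  · simp only [if_pos hp, mertensExp, one_div]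
    split_ifs <;> (push_cast; ring)
  · simp [hp]

open scoped Classical in
theorem exists_tendsto_totient_mul_log_mertensProd {q : ℕ} [NeZero q] {a : ℤ}
    (ha : IsCoprime a (q : ℤ)) {B : ℝ} (hB : 0 ≤ B)
    (hBq : ∀ p : ℕ, p.Prime → p ∣ q → (p : ℝ) ≤ B) :
    ∃ R : ℝ, Tendsto (fun x => (q.totient : ℝ) * Real.log (mertensProd q a x) +
        Real.log (Real.log x)) atTop (𝓝 R) ∧
      (R : ℂ) = -(Real.eulerMascheroniConstant : ℂ) +
        ((Real.log (∏ p ∈ primesUpTo B, (1 - 1 / (p : ℝ)) ^ mertensExp q a p) : ℝ) : ℂ) -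
        ∑ χ : DirichletCharacter ℂ q with χ ≠ 1, (starRingEnd ℂ) (χ (a : ZMod q)) *
          ∑' m : ℕ+, 1 / ((m : ℕ) : ℂ) * ∑' k : ℕ+, moebiusTerm χ B m k := by
  obtain ⟨t, ht, hlim⟩ := tendsto_sum_mertensExp_mul_neg_log ha hB hBq
  refine ⟨-Real.eulerMascheroniConstant +
    Real.log (∏ p ∈ primesUpTo B, (1 - 1 / (p : ℝ)) ^ mertensExp q a p) - t, ?_, ?_⟩
  · have hfl := tendsto_nat_floor_atTop (α := ℝ)
    have h1 := hlim.comp hfl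
    have h2 := tendsto_sum_primes_neg_log_sub_log_log.comp ((tendsto_add_atTop_nat 1).comp hfl)
    have h3 := ((h2.add tendsto_log_log_floor_sub_log_log).neg.add_const
      (Real.log (∏ p ∈ primesUpTo B, (1 - 1 / (p : ℝ)) ^ mertensExp q a p))).sub h1
    rw [add_zero] at h3
    refine h3.congr' ?_
    filter_upwards [hfl.eventually_ge_atTop ⌊B⌋₊] with x hx
    rw [totient_mul_log_mertensProd, sum_range_ite_prime_eq
      (fun n => (mertensExp q a n : ℝ) * -Real.log (1 - (n : ℝ)⁻¹)) hB hx, log_prod_mertensExp]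
    simp only [Function.comp_apply]
    ring
  · rw [ht]
    push_cast
    rfl

theorem tendsto_mertensProd_mul_log_rpow {q : ℕ} [NeZero q] {a : ℤ} {R : ℝ}
    (h : Tendsto (fun x => (q.totient : ℝ) * Real.log (mertensProd q a x) +
        Real.log (Real.log x)) atTop (𝓝 R)) :
    Tendsto (fun x : ℝ => mertensProd q a x * (Real.log x) ^ (1 / (q.totient : ℝ))) atTop
      (𝓝 (Real.exp (R / q.totient))) := by
  have hφ : (q.totient : ℝ) ≠ 0 := by
    exact_mod_cast (Nat.totient_pos.2 (NeZero.pos q)).ne'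
  refine ((Real.continuous_exp.tendsto _).comp (h.div_const (q.totient : ℝ))).congr' ?_
  filter_upwards [eventually_gt_atTop 1] with x hx
  have hl : 0 < Real.log x := Real.log_pos hx
  rw [Function.comp_apply, add_div, mul_div_cancel_left₀ _ hφ, Real.exp_add,
    Real.exp_log (mertensProd_pos q a x), Real.rpow_def_of_pos hl, mul_one_div]

open scoped Classical in
theorem mainTheorem2 (q : ℕ) [NeZero q] (hq : 3 ≤ q) (a : ℤ) (ha : IsCoprime a (q : ℤ))
    (A : ℝ) (hA : 0 < A) (hAq : ∀ p : ℕ, p.Prime → p ∣ q → (p : ℝ) ≤ A * (q : ℝ)) :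
    -- the constant `C(q, a)` exists and is positive
    (0 < mertensConst q a ∧
      mertensProd q a ~[atTop]
        fun x : ℝ => mertensConst q a / (Real.log x) ^ (1 / (Nat.totient q : ℝ))) ∧
    -- the truncated Euler products and their logarithms converge
    (∀ χ : DirichletCharacter ℂ q, χ ≠ 1 → ∀ m k : ℕ+, ∀ s : ℂ,
      s = (((k : ℕ) * (m : ℕ) : ℕ) : ℂ) →
        Tendsto (eulerTailPartial (χ ^ (k : ℕ)) (A * q) s) atTop
          (𝓝 (eulerTail (χ ^ (k : ℕ)) (A * q) s)) ∧
        Tendsto (logEulerTailPartial (χ ^ (k : ℕ)) (A * q) s) atTop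
          (𝓝 (logEulerTail (χ ^ (k : ℕ)) (A * q) s)) ∧
        Complex.exp (logEulerTail (χ ^ (k : ℕ)) (A * q) s) =
          eulerTail (χ ^ (k : ℕ)) (A * q) s) ∧
    -- the inner and outer series converge
    (∀ χ : DirichletCharacter ℂ q, χ ≠ 1 →
      (∀ m : ℕ+, Summable fun k : ℕ+ => moebiusTerm χ (A * q) m k) ∧
      Summable fun m : ℕ+ => 1 / ((m : ℕ) : ℂ) * ∑' k : ℕ+, moebiusTerm χ (A * q) m k) ∧
    -- the formula
    (((Nat.totient q : ℝ) * Real.log (mertensConst q a) : ℝ) : ℂ) =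
      -(Real.eulerMascheroniConstant : ℂ)
      + ((Real.log (∏ p ∈ primesUpTo (A * q),
          (1 - 1 / (p : ℝ)) ^ mertensExp q a p) : ℝ) : ℂ)
      - ∑ χ : DirichletCharacter ℂ q with χ ≠ 1,
          (starRingEnd ℂ) (χ (a : ZMod q)) *
            ∑' m : ℕ+, 1 / ((m : ℕ) : ℂ) * ∑' k : ℕ+, moebiusTerm χ (A * q) m k := by
  have hB : 0 ≤ A * (q : ℝ) := by positivity
  have hφ : (q.totient : ℝ) ≠ 0 := by
    exact_mod_cast (Nat.totient_pos.2 (NeZero.pos q)).ne'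
  obtain ⟨R, hR, hRC⟩ := exists_tendsto_totient_mul_log_mertensProd ha hB hAq
  have hlim := tendsto_mertensProd_mul_log_rpow hR
  have hC : mertensConst q a = Real.exp (R / q.totient) := hlim.limUnder_eq
  refine ⟨⟨hC ▸ Real.exp_pos _, ?_⟩, ?_, fun χ hχ => ⟨(exists_moebiusTerm_bounds hχ hB).1,
    summable_one_div_mul_tsum_moebiusTerm hχ hB⟩, ?_⟩
  · refine isEquivalent_of_tendsto_one ?_
    have h1 := hlim.div_const (mertensConst q a)
    -- Dividing by the constant is legitimate because it is an exponential, hence nonzero.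
    rw [← hC, div_self (hC ▸ (Real.exp_pos _).ne')] at h1
    refine h1.congr fun x => ?_
    rw [Pi.div_apply, div_div_eq_mul_div]
  · rintro χ hχ m k s rfl
    have hs : (k : ℕ) * (m : ℕ) ≠ 0 := (Nat.mul_pos k.pos m.pos).ne'
    have h1 : (k : ℕ) * (m : ℕ) = 1 → χ ^ (k : ℕ) ≠ 1 := fun h => by
      rwa [Nat.eq_one_of_mul_eq_one_right h, pow_one]
    have h2 := tendsto_eulerTailPartial (χ ^ (k : ℕ)) hB hs h1
    exact ⟨h2.1, tendsto_logEulerTailPartial (χ ^ (k : ℕ)) hB hs h1, h2.2⟩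
  · rw [← hRC, hC, Real.log_exp, mul_div_cancel₀ _ hφ]
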